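/- **Lemma (Integrity of Client Registration).** We work in the symbolic (Dolev–Yao style) Web Infrastructure Model of Fett, Küsters and Schmitz. Messages are ground terms over nonces, IP addresses, ASCII strings and $\top,\bot,\diamond$, built from public-key and symmetric encryption, signatures, tuples and projections, modulo the usual equational theory $\equiv$. A configuration $(S,E,N)$ consists of the states $S(p)$ of all processes $p$, the sequence $E$ of waiting events and the sequence $N$ of unused nonces; in a processing step one process handles one waiting event. For a sequence $t$, $u \in^{\langle\rangle} t$ means that $u$ is (modulo $\equiv$) one of the elements of $t$; for a dictionary $t$, $t[k]$ is the value stored under $k$ (the empty tuple $\langle\rangle$ if there is none). An *OIDC web system* consists of a finite set of web browsers, a finite set of relying parties (RPs) and a finite set of identity providers (IdPs), which run the Web Infrastructure Model's browser and the RP and IdP servers of OpenID Connect (with discovery and dynamic client registration), together with either - a single network attacker, which listens to and can spoof all IP addresses (system *with a network attacker*), or - finitely many web attackers, which only use their own IP addresses, and an honest DNS server that is used by all honest parties (system *with web attackers*). Each process $p$ has a finite set $\mathsf{dom}(p)$ of domains, and these sets are pairwise disjoint. RPs and IdPs become corrupted when they receive the message $\mathtt{CORRUPT}$; an RP or IdP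 $p$ is *honest in* $S$ iff $S(p).\mathtt{corrupt}\equiv\bot$. An RP registers at an IdP by sending an HTTPS request whose body contains, under the key $\mathtt{redirect\_uris}$, a sequence of URLs; the IdP stores the request. When it later receives a message $c$ (from anybody) that is not yet a client id in its dictionary $\mathtt{clients}$, it may use $c$ as the client id for one of the stored requests: it stores a record for $c$ in $\mathtt{clients}$ (containing the request's value of $\mathtt{redirect\_uris}$) and sends a response with $c$ in its body under the key $\mathtt{client\_id}$. We say that a client id $c$ *has been issued to the RP $r$ by the IdP $i$* in a run if in that run $i$ has sent such a response, with $c$ under the key $\mathtt{client\_id}$, to a registration request that was sent by $r$. Then for any run $\rho$ (finite or infinite) of an OIDC web system with a network attacker or of an OIDC web system with web attackers, every configuration $(S,E,N)$ in $\rho$, every IdP $i$ that is honest in $S$, every RP $r$ that is honest in $S$, every client id $c$ that has been issued to $r$ by $i$ in $\rho$, and every URL $u \in^{\langle\rangle} S(i).\mathtt{clients}[c][\mathtt{redirect\_uris}]$, we have $$u.\mathtt{host}\in\mathsf{dom}(r)\quad\text{and}\quad u.\mathtt{protocol}\equiv \mathtt{S},$$ where the string $\mathtt{S}$ denotes the protocol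 HTTPS. -/

import Mathlib

/-! # Terms, the equational theory, and Dolev-Yao derivability -/

namespace OIDC

/-- ASCII strings, as lists of character codes. -/
abbrev Str := List (Fin 128)

/-- Terms over addresses `A`, nonces `N` and variables (placeholders) `V`. -/
inductive Term (A N V : Type) : Type
  | nonce (n : N)
  | var (v : V)
  | addr (a : A)
  | str (s : Str)
  | top
  | bot
  | undef
  | pub (t : Term A N V)
  | enc (t u : Term A N V)
  | dec (t u : Term A N V)
  | encs (t u : Term A N V)
  | decs (t u : Term A N V)
  | sig (t u : Term A N V)
  | checksig (t u : Term A N V)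
  | extractmsg (t : Term A N V)
  | seq (l : List (Term A N V))
  | proj (i : ℕ) (t : Term A N V)

/-- Messages: ground terms. -/
abbrev Msg (A N : Type) := Term A N Empty

/-- Terms that may contain the placeholders `ν_0, ν_1, …`. The same type, read with the script
variables `λ_0, λ_1, …` as variables, is used for the outputs of scripts. -/
abbrev PTerm (A N : Type) := Term A N ℕ

instance {A N V : Type} : Coe Str (Term A N V) := ⟨Term.str⟩

namespace Term

variable {A N N' V W : Type}

mutual
/-- Simultaneous replacement of nonces and variables by terms. -/
def bind (fn : N → Term A N' W) (fv : V → Term A N' W) : Term A N V → Term A N' W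
  | nonce n => fn n
  | var v => fv v
  | addr a => addr a
  | str s => str s
  | top => top
  | bot => bot
  | undef => undef
  | pub t => pub (bind fn fv t)
  | enc t u => enc (bind fn fv t) (bind fn fv u)
  | dec t u => dec (bind fn fv t) (bind fn fv u)
  | encs t u => encs (bind fn fv t) (bind fn fv u)
  | decs t u => decs (bind fn fv t) (bind fn fv u)
  | sig t u => sig (bind fn fv t) (bind fn fv u)
  | checksig t u => checksig (bind fn fv t) (bind fn fv u)
  | extractmsg t => extractmsg (bind fn fv t)
  | seq l => seq (bindList fn fv l)
  | proj i t => proj i (bind fn fv t)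
def bindList (fn : N → Term A N' W) (fv : V → Term A N' W) :
    List (Term A N V) → List (Term A N' W)
  | [] => []
  | t :: l => bind fn fv t :: bindList fn fv l
end

mutual
/-- The variables that occur in a term. -/
def vars : Term A N V → List V
  | nonce _ => []
  | var v => [v]
  | addr _ => []
  | str _ => []
  | top => []
  | bot => []
  | undef => []
  | pub t => vars t
  | enc t u => vars t ++ vars u
  | dec t u => vars t ++ vars u
  | encs t u => vars t ++ vars u
  | decs t u => vars t ++ vars u
  | sig t u => vars t ++ vars u
  | checksig t u => vars t ++ vars u
  | extractmsg t => vars t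
  | seq l => varsList l
  | proj _ t => vars t
def varsList : List (Term A N V) → List V
  | [] => []
  | t :: l => vars t ++ varsList l
end

/-- Replacement of variables. -/
def subst (fv : V → Term A N W) (t : Term A N V) : Term A N W := t.bind nonce fv

/-- A message, seen as a term with variables. -/
def lift (t : Msg A N) : Term A N V := t.subst Empty.elim

/-! The root reductions of the equational theory. -/

noncomputable section
open scoped Classical

def redDec : Term A N V → Term A N V → Term A N V
  | enc x (pub y), k => if y = k then x else dec (enc x (pub y)) k
  | t, k => dec t k

def redDecs : Term A N V → Term A N V → Term A N V
  | encs x y, k => if y = k then x else decs (encs x y) k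
  | t, k => decs t k

def redChecksig : Term A N V → Term A N V → Term A N V
  | sig x y, pub z => if y = z then top else checksig (sig x y) (pub z)
  | t, k => checksig t k

def redExtractmsg : Term A N V → Term A N V
  | sig x _ => x
  | t => extractmsg t

def redProj (i : ℕ) : Term A N V → Term A N V
  | seq l => if i = 0 then undef else (l[i - 1]?).getD undef
  | t => proj i t

mutual
/-- The normal form of a term with respect to the equational theory. -/
def nf : Term A N V → Term A N V
  | nonce n => nonce n
  | var v => var v
  | addr a => addr a
  | str s => str s
  | top => top
  | bot => bot
  | undef => undef
  | pub t => pub (nf t)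
  | enc t u => enc (nf t) (nf u)
  | dec t u => redDec (nf t) (nf u)
  | encs t u => encs (nf t) (nf u)
  | decs t u => redDecs (nf t) (nf u)
  | sig t u => sig (nf t) (nf u)
  | checksig t u => redChecksig (nf t) (nf u)
  | extractmsg t => redExtractmsg (nf t)
  | seq l => seq (nfList l)
  | proj i t => redProj i (nf t)
def nfList : List (Term A N V) → List (Term A N V)
  | [] => []
  | t :: l => nf t :: nfList l
end

end

/-- `t ≡ₜ u`: the terms are equal modulo the equational theory (see `eqv_iff_cong`). -/
def Eqv (t u : Term A N V) : Prop := t.nf = u.nf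

/-- The congruence relation generated by the equations of the theory. -/
inductive Cong : Term A N V → Term A N V → Prop
  | refl (t) : Cong t t
  | symm {t u} : Cong t u → Cong u t
  | trans {t u v} : Cong t u → Cong u v → Cong t v
  | pub {t t'} : Cong t t' → Cong (.pub t) (.pub t')
  | enc {t t' u u'} : Cong t t' → Cong u u' → Cong (.enc t u) (.enc t' u')
  | dec {t t' u u'} : Cong t t' → Cong u u' → Cong (.dec t u) (.dec t' u')
  | encs {t t' u u'} : Cong t t' → Cong u u' → Cong (.encs t u) (.encs t' u')
  | decs {t t' u u'} : Cong t t' → Cong u u' → Cong (.decs t u) (.decs t' u')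
  | sig {t t' u u'} : Cong t t' → Cong u u' → Cong (.sig t u) (.sig t' u')
  | checksig {t t' u u'} : Cong t t' → Cong u u' → Cong (.checksig t u) (.checksig t' u')
  | extractmsg {t t'} : Cong t t' → Cong (.extractmsg t) (.extractmsg t')
  | seq (l₁ l₂) {t t'} : Cong t t' → Cong (.seq (l₁ ++ t :: l₂)) (.seq (l₁ ++ t' :: l₂))
  | proj (i) {t t'} : Cong t t' → Cong (.proj i t) (.proj i t')
  | dec_enc (x y) : Cong (.dec (.enc x (.pub y)) y) x
  | decs_encs (x y) : Cong (.decs (.encs x y) y) x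
  | checksig_sig (x y) : Cong (.checksig (.sig x y) (.pub y)) .top
  | extractmsg_sig (x y) : Cong (.extractmsg (.sig x y)) x
  | proj_seq (l : List (Term A N V)) (i : ℕ) (x) (h : l[i]? = some x) :
      Cong (.proj (i + 1) (.seq l)) x
  | proj_undef (l : List (Term A N V)) (i : ℕ) (h : i ∉ Finset.Icc 1 l.length) :
      Cong (.proj i (.seq l)) .undef

theorem nfList_eq_map (l : List (Term A N V)) : nfList l = l.map nf := by
  induction l with
  | nil => rfl
  | cons t l ih => simp [nfList, ih]

theorem Cong.seq_map (g : Term A N V → Term A N V) (l : List (Term A N V))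
    (h : ∀ t ∈ l, Cong t (g t)) (l₀ : List (Term A N V)) :
    Cong (.seq (l₀ ++ l)) (.seq (l₀ ++ l.map g)) := by
  induction l generalizing l₀ with
  | nil => exact .refl _
  | cons t l ih =>
    have h1 : Cong (.seq (l₀ ++ t :: l)) (.seq (l₀ ++ g t :: l)) :=
      .seq l₀ l (h t (by simp))
    have h2 := ih (fun u hu => h u (by simp [hu])) (l₀ ++ [g t])
    simp only [List.append_assoc, List.singleton_append] at h2
    exact h1.trans h2

theorem cong_nf : ∀ t : Term A N V, Cong t t.nf
  | .nonce _ => .refl _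
  | .var _ => .refl _
  | .addr _ => .refl _
  | .str _ => .refl _
  | .top => .refl _
  | .bot => .refl _
  | .undef => .refl _
  | .pub t => .pub (cong_nf t)
  | .enc t u => .enc (cong_nf t) (cong_nf u)
  | .encs t u => .encs (cong_nf t) (cong_nf u)
  | .sig t u => .sig (cong_nf t) (cong_nf u)
  | .dec t u => by
    refine (Cong.dec (cong_nf t) (cong_nf u)).trans ?_
    simp only [nf]
    generalize t.nf = a, u.nf = b
    unfold redDec
    split
    · split_ifs with h
      · subst h; exact .dec_enc _ _
      · exact .refl _
    · exact .refl _
  | .decs t u => by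
    refine (Cong.decs (cong_nf t) (cong_nf u)).trans ?_
    simp only [nf]
    generalize t.nf = a, u.nf = b
    unfold redDecs
    split
    · split_ifs with h
      · subst h; exact .decs_encs _ _
      · exact .refl _
    · exact .refl _
  | .checksig t u => by
    refine (Cong.checksig (cong_nf t) (cong_nf u)).trans ?_
    simp only [nf]
    generalize t.nf = a, u.nf = b
    unfold redChecksig
    split
    · split_ifs with h
      · subst h; exact .checksig_sig _ _
      · exact .refl _
    · exact .refl _
  | .extractmsg t => by
    refine (Cong.extractmsg (cong_nf t)).trans ?_
    simp only [nf]
    generalize t.nf = a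
    unfold redExtractmsg
    split
    · exact .extractmsg_sig _ _
    · exact .refl _
  | .proj i t => by
    refine (Cong.proj i (cong_nf t)).trans ?_
    simp only [nf]
    generalize t.nf = a
    unfold redProj
    split
    · next l =>
      split_ifs with h
      · subst h; exact .proj_undef _ _ (by simp)
      · obtain ⟨j, rfl⟩ := Nat.exists_eq_succ_of_ne_zero h
        simp only [Nat.succ_eq_add_one, Nat.add_sub_cancel]
        cases hx : l[j]? with
        | some x => exact .proj_seq _ _ _ hx
        | none =>
          refine .proj_undef _ _ ?_
          have := List.getElem?_eq_none_iff.1 hx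
          simp; omega
    · exact .refl _
  | .seq l => by
    have h : ∀ t ∈ l, Cong t t.nf := fun t _ => cong_nf t
    simpa [nf, nfList_eq_map] using Cong.seq_map nf l h []

theorem nf_eq_of_cong {t u : Term A N V} (h : Cong t u) : t.nf = u.nf := by
  induction h with
  | refl => rfl
  | symm _ ih => exact ih.symm
  | trans _ _ ih ih' => exact ih.trans ih'
  | seq l₁ l₂ _ ih => simp [nf, nfList_eq_map, ih]
  | proj_seq l i x h => simp [nf, nfList_eq_map, redProj, h]
  | proj_undef l i h =>
    simp only [nf, nfList_eq_map, redProj]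
    split_ifs with h0
    · rfl
    · have : l.length ≤ i - 1 := by simp at h; omega
      rw [List.getElem?_eq_none (by simpa using this)]
      rfl
  | _ => simp_all [nf, redDec, redDecs, redChecksig, redExtractmsg]

/-- Equality of normal forms is the congruence generated by the equational theory. -/
theorem eqv_iff_cong (t u : Term A N V) : Eqv t u ↔ Cong t u :=
  ⟨fun h => (cong_nf t).trans (h ▸ (cong_nf u).symm), nf_eq_of_cong⟩

end Term

infix:50 " ≡ₜ " => Term.Eqv

/-- `derivable M` is the set of the terms that can be derived from `M` with the variables `V`:
those of the form `τ[m₁/x₁, …, mₙ/xₙ]` (modulo `≡ₜ`) for a nonce-free term `τ` over variables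
`x₁, …, xₙ` and `V`. -/
def derivable {A N V : Type} (M : Set (Term A N V)) : Set (Term A N V) :=
  {t | ∃ τ : Term A Empty (M ⊕ V), t ≡ₜ τ.bind Empty.elim (Sum.elim Subtype.val Term.var)}

/-! # Sequences, dictionaries, pointers -/

section Data

variable {A N V : Type}

/-- The elements of a sequence, in normal form (none if the term is not a sequence). -/
noncomputable def elems (t : Term A N V) : List (Term A N V) :=
  match t.nf with
  | .seq l => l
  | _ => []

/-- `x ∈⟨⟩ t` -/
def Mem (x t : Term A N V) : Prop := ∃ y ∈ elems t, x ≡ₜ y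

/-- Appending one element to a sequence. -/
noncomputable def snoc (t x : Term A N V) : Term A N V := .seq (elems t ++ [x])

/-- Concatenation of sequences. -/
noncomputable def union (t u : Term A N V) : Term A N V := .seq (elems t ++ elems u)

/-- `⟨M⟩` for a finite set `M`: the order of the elements is chosen arbitrarily. -/
def seqOf (M : Set (Term A N V)) : Set (Term A N V) :=
  {t | ∃ l : List (Term A N V), l.Nodup ∧ (∀ x, x ∈ l ↔ x ∈ M) ∧ t = .seq l}

/-- Removing one occurrence of an element from a sequence. -/
def removeElem (t x : Term A N V) : Set (Term A N V) :=
  {u | ∃ l₁ l₂ y, elems t = l₁ ++ y :: l₂ ∧ y ≡ₜ x ∧ u = .seq (l₁ ++ l₂)}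

/-- The dictionary `[k₁ : v₁, …, kₙ : vₙ]`. -/
def dict (l : List (Term A N V × Term A N V)) : Term A N V := .seq (l.map fun p => .seq [p.1, p.2])

/-- `k ∈ z` for a dictionary `z`. -/
def HasKey (z k : Term A N V) : Prop := ∃ v, .seq [k.nf, v] ∈ elems z

/-- The possible values of `z[k]` (more than one if a key is repeated, `⟨⟩` if there is none). -/
def lookup (z k : Term A N V) : Set (Term A N V) :=
  {v | .seq [k.nf, v] ∈ elems z ∨ (¬ HasKey z k ∧ v = .seq [])}

/-- The possible results of `z[k] := v`. -/
def update (z k v : Term A N V) : Set (Term A N V) :=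
  {z' | (∃ l₁ v₀ l₂, elems z = l₁ ++ .seq [k.nf, v₀] :: l₂ ∧
          z' = .seq (l₁ ++ .seq [k, v] :: l₂)) ∨
        (¬ HasKey z k ∧ z' = .seq (elems z ++ [.seq [k, v]]))}

/-- The possible results of `z - k`. -/
def removeKey (z k : Term A N V) : Set (Term A N V) :=
  {z' | (∃ l₁ v₀ l₂, elems z = l₁ ++ .seq [k.nf, v₀] :: l₂ ∧ z' = .seq (l₁ ++ l₂)) ∨
        (¬ HasKey z k ∧ z' = z)}

/-- The `i`-th component `t.i` of a term (counted from 1). -/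
noncomputable def comp (t : Term A N V) (i : ℕ) : Term A N V := (Term.proj i t).nf

/-- The subterm `t.p` at a pointer. -/
noncomputable def at' (t : Term A N V) (p : List ℕ) : Term A N V := p.foldl comp t

/-- `t.p := v`; nothing happens if `p` does not point into `t`. -/
noncomputable def setAt (t : Term A N V) : List ℕ → Term A N V → Term A N V
  | [], v => v
  | i :: p, v =>
    if i ∈ Finset.Icc 1 (elems t).length then .seq ((elems t).set (i - 1) (setAt (comp t i) p v))
    else t

def IsPair (t : Term A N V) : Prop := ∃ x y, t ≡ₜ .seq [x, y]

def IsNonce (t : Term A N V) : Prop := ∃ n, t ≡ₜ .nonce n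

def IsAddr (t : Term A N V) : Prop := ∃ a, t ≡ₜ .addr a

end Data

/-! # Atomic processes, systems, runs -/

/-- Events with receiver `dst` and sender `src`. -/
structure Event (A T : Type) where
  dst : A
  src : A
  msg : T

def Event.toTerm {A N V : Type} (e : Event A (Term A N V)) : Term A N V :=
  .seq [.addr e.dst, .addr e.src, e.msg]

/-- Atomic processes; the set of states is the set of all messages. -/
structure AtomicProcess (A N : Type) where
  addrs : Set A
  rel : Event A (Msg A N) → Msg A N → List (Event A (PTerm A N)) → PTerm A N → Prop
  init : Msg A N

/-- Configurations `(S, E, N)` of a system whose processes are indexed by `P`. -/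
structure Config (P A N : Type) where
  S : P → Msg A N
  E : Stream' (Event A (Msg A N))
  N : Stream' N

/-- The placeholders in the output of a process. -/
def placeholders {A N : Type} (E : List (Event A (PTerm A N))) (s : PTerm A N) : Finset ℕ :=
  (s.vars ++ E.flatMap fun e => e.msg.vars).toFinset

/-- Replacement of the `j`-th placeholder that occurs (in increasing order) by the `j`-th unused
nonce. -/
def instantiate {A N : Type} (vs : Finset ℕ) (ν : Stream' N) (t : PTerm A N) : Msg A N :=
  t.subst fun v => .nonce (ν.get (vs.filter (· < v)).card)

/-- The processing step in which the process `p` handles the event `e` with the output `E` and the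
new state `s` (both with placeholders), and emits `Eout`. -/
structure StepWith {P A N : Type} (sys : P → AtomicProcess A N) (c : Config P A N)
    (e : Event A (Msg A N)) (p : P) (E : List (Event A (PTerm A N))) (s : PTerm A N)
    (Eout : List (Event A (Msg A N))) (c' : Config P A N) : Prop where
  rel : (sys p).rel e (c.S p) E s
  addr : e.dst ∈ (sys p).addrs
  out : Eout = E.map fun ev => ⟨ev.dst, ev.src, instantiate (placeholders E s) c.N ev.msg⟩
  state : c'.S p = instantiate (placeholders E s) c.N s
  state_ne : ∀ q, q ≠ p → c'.S q = c.S q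
  events : ∃ k, c.E.get k = e ∧ c'.E = Eout ++ₛ (c.E.take k ++ₛ c.E.drop (k + 1))
  nonces : c'.N = c.N.drop (placeholders E s).card

/-- Processing steps. -/
def Step {P A N : Type} (sys : P → AtomicProcess A N) (c c' : Config P A N) : Prop :=
  ∃ e p E s Eout, StepWith sys c e p E s Eout c'

/-- A finite or infinite run (`len` is the number of its processing steps). The values of `conf`
beyond `len` carry no meaning. -/
structure Run {P A N : Type} (sys : P → AtomicProcess A N) (E₀ : Stream' (Event A (Msg A N)))
    (N₀ : Stream' N) where
  len : ℕ∞
  conf : ℕ → Config P A N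
  init_S : ∀ p, (conf 0).S p = (sys p).init
  init_E : (conf 0).E = E₀
  init_N : (conf 0).N = N₀
  step : ∀ n : ℕ, (n : ℕ∞) < len → Step sys (conf n) (conf (n + 1))

/-- The relation of an attacker process for the set `src` of sender addresses. -/
def attackerRel {A N : Type} (src : Set A) (e : Event A (Msg A N)) (s : Msg A N)
    (E : List (Event A (PTerm A N))) (s' : PTerm A N) : Prop :=
  s' = .seq [e.toTerm.lift, .seq (E.map Event.toTerm), s.lift] ∧
  ∀ ev ∈ E, ev.src ∈ src ∧ ev.msg ∈ derivable {e.toTerm.lift, s.lift}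

/-! # String constants, by character codes (the comment gives the string where it is not the name) -/

namespace K

def HTTPReq : Str := [72, 84, 84, 80, 82, 101, 113]
def HTTPResp : Str := [72, 84, 84, 80, 82, 101, 115, 112]
def URL : Str := [85, 82, 76]
def HTTP : Str := [80] -- P
def HTTPS : Str := [83] -- S
def GET : Str := [71, 69, 84]
def POST : Str := [80, 79, 83, 84]
def HEAD : Str := [72, 69, 65, 68]
def CONNECT : Str := [67, 79, 78, 78, 69, 67, 84]
def TRACE : Str := [84, 82, 65, 67, 69]
def TRACK : Str := [84, 82, 65, 67, 75]
def TRIGGER : Str := [84, 82, 73, 71, 71, 69, 82]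
def CORRUPT : Str := [67, 79, 82, 82, 85, 80, 84]
def FULLCORRUPT : Str := [70, 85, 76, 76, 67, 79, 82, 82, 85, 80, 84]
def CLOSECORRUPT : Str := [67, 76, 79, 83, 69, 67, 79, 82, 82, 85, 80, 84]
def DNSResolve : Str := [68, 78, 83, 82, 101, 115, 111, 108, 118, 101]
def DNSResolved : Str := [68, 78, 83, 82, 101, 115, 111, 108, 118, 101, 100]
def HREF : Str := [72, 82, 69, 70]
def IFRAME : Str := [73, 70, 82, 65, 77, 69]
def FORM : Str := [70, 79, 82, 77]
def SETSCRIPT : Str := [83, 69, 84, 83, 67, 82, 73, 80, 84]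
def SETSCRIPTSTATE : Str := [83, 69, 84, 83, 67, 82, 73, 80, 84, 83, 84, 65, 84, 69]
def XMLHTTPREQUEST : Str := [88, 77, 76, 72, 84, 84, 80, 82, 69, 81, 85, 69, 83, 84]
def BACK : Str := [66, 65, 67, 75]
def FORWARD : Str := [70, 79, 82, 87, 65, 82, 68]
def CLOSE : Str := [67, 76, 79, 83, 69]
def POSTMESSAGE : Str := [80, 79, 83, 84, 77, 69, 83, 83, 65, 71, 69]
def BLANK : Str := [95, 66, 76, 65, 78, 75] -- _BLANK
def s200 : Str := [50, 48, 48] -- 200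
def s201 : Str := [50, 48, 49] -- 201
def s303 : Str := [51, 48, 51] -- 303
def s307 : Str := [51, 48, 55] -- 307
def Origin : Str := [79, 114, 105, 103, 105, 110]
def SetCookie : Str := [83, 101, 116, 45, 67, 111, 111, 107, 105, 101] -- Set-Cookie
def Cookie : Str := [67, 111, 111, 107, 105, 101]
def Location : Str := [76, 111, 99, 97, 116, 105, 111, 110]
def Referer : Str := [82, 101, 102, 101, 114, 101, 114]
def STS : Str := [83, 116, 114, 105, 99, 116, 45, 84, 114, 97, 110, 115, 112, 111, 114, 116, 45, 83, 101, 99, 117, 114, 105, 116, 121] -- Strict-Transport-Security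
def Authorization : Str := [65, 117, 116, 104, 111, 114, 105, 122, 97, 116, 105, 111, 110]
def ReferrerPolicy : Str := [82, 101, 102, 101, 114, 114, 101, 114, 80, 111, 108, 105, 99, 121]
def noreferrer : Str := [110, 111, 114, 101, 102, 101, 114, 114, 101, 114]
def origin : Str := [111, 114, 105, 103, 105, 110]
def att_script : Str := [97, 116, 116, 95, 115, 99, 114, 105, 112, 116]
def script_rp_index : Str := [115, 99, 114, 105, 112, 116, 95, 114, 112, 95, 105, 110, 100, 101, 120]
def script_rp_get_fragment : Str := [115, 99, 114, 105, 112, 116, 95, 114, 112, 95, 103, 101, 116, 95, 102, 114, 97, 103, 109, 101, 110, 116]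
def script_idp_form : Str := [115, 99, 114, 105, 112, 116, 95, 105, 100, 112, 95, 102, 111, 114, 109]
def pRoot : Str := [47] -- /
def pStartLogin : Str := [47, 115, 116, 97, 114, 116, 76, 111, 103, 105, 110] -- /startLogin
def pRedirectEp : Str := [47, 114, 101, 100, 105, 114, 101, 99, 116, 95, 101, 112] -- /redirect_ep
def pWebfinger : Str := [47, 46, 119, 107, 47, 119, 101, 98, 102, 105, 110, 103, 101, 114] -- /.wk/webfinger
def pConfig : Str := [47, 46, 119, 107, 47, 111, 112, 101, 110, 105, 100, 45, 99, 111, 110, 102, 105, 103, 117, 114, 97, 116, 105, 111, 110] -- /.wk/openid-configuration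
def pJwks : Str := [47, 106, 119, 107, 115] -- /jwks
def pReg : Str := [47, 114, 101, 103] -- /reg
def pAuth : Str := [47, 97, 117, 116, 104] -- /auth
def pAuth2 : Str := [47, 97, 117, 116, 104, 50] -- /auth2
def pToken : Str := [47, 116, 111, 107, 101, 110] -- /token
def session : Str := [115, 101, 115, 115, 105, 111, 110]
def responseTo : Str := [114, 101, 115, 112, 111, 110, 115, 101, 84, 111]
def WEBFINGER : Str := [87, 69, 66, 70, 73, 78, 71, 69, 82]
def CONFIG : Str := [67, 79, 78, 70, 73, 71]
def JWKS : Str := [74, 87, 75, 83]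
def REGISTRATION : Str := [82, 69, 71, 73, 83, 84, 82, 65, 84, 73, 79, 78]
def TOKEN : Str := [84, 79, 75, 69, 78]
def RESOURCE_USAGE : Str := [82, 69, 83, 79, 85, 82, 67, 69, 95, 85, 83, 65, 71, 69]
def identity : Str := [105, 100, 101, 110, 116, 105, 116, 121]
def subject : Str := [115, 117, 98, 106, 101, 99, 116]
def links : Str := [108, 105, 110, 107, 115]
def rel : Str := [114, 101, 108]
def href : Str := [104, 114, 101, 102]
def OIDC_issuer : Str := [79, 73, 68, 67, 95, 105, 115, 115, 117, 101, 114]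
def issuer : Str := [105, 115, 115, 117, 101, 114]
def response_type : Str := [114, 101, 115, 112, 111, 110, 115, 101, 95, 116, 121, 112, 101]
def code : Str := [99, 111, 100, 101]
def id_token : Str := [105, 100, 95, 116, 111, 107, 101, 110]
def token : Str := [116, 111, 107, 101, 110]
def access_token : Str := [97, 99, 99, 101, 115, 115, 95, 116, 111, 107, 101, 110]
def token_type : Str := [116, 111, 107, 101, 110, 95, 116, 121, 112, 101]
def bearer : Str := [98, 101, 97, 114, 101, 114]
def Bearer : Str := [66, 101, 97, 114, 101, 114]
def startRequest : Str := [115, 116, 97, 114, 116, 82, 101, 113, 117, 101, 115, 116]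
def redirectEpRequest : Str := [114, 101, 100, 105, 114, 101, 99, 116, 69, 112, 82, 101, 113, 117, 101, 115, 116]
def message : Str := [109, 101, 115, 115, 97, 103, 101]
def key : Str := [107, 101, 121]
def receiver : Str := [114, 101, 99, 101, 105, 118, 101, 114]
def sender : Str := [115, 101, 110, 100, 101, 114]
def sessionId : Str := [115, 101, 115, 115, 105, 111, 110, 73, 100]
def serviceSessionId : Str := [115, 101, 114, 118, 105, 99, 101, 83, 101, 115, 115, 105, 111, 110, 73, 100]
def loggedInAs : Str := [108, 111, 103, 103, 101, 100, 73, 110, 65, 115]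
def state : Str := [115, 116, 97, 116, 101]
def nonce : Str := [110, 111, 110, 99, 101]
def iss : Str := [105, 115, 115]
def aud : Str := [97, 117, 100]
def sub : Str := [115, 117, 98]
def grant_type : Str := [103, 114, 97, 110, 116, 95, 116, 121, 112, 101]
def authorization_code : Str := [97, 117, 116, 104, 111, 114, 105, 122, 97, 116, 105, 111, 110, 95, 99, 111, 100, 101]
def redirect_uri : Str := [114, 101, 100, 105, 114, 101, 99, 116, 95, 117, 114, 105]
def redirect_uris : Str := [114, 101, 100, 105, 114, 101, 99, 116, 95, 117, 114, 105, 115]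
def client_id : Str := [99, 108, 105, 101, 110, 116, 95, 105, 100]
def client_secret : Str := [99, 108, 105, 101, 110, 116, 95, 115, 101, 99, 114, 101, 116]
def auth_ep : Str := [97, 117, 116, 104, 95, 101, 112]
def token_ep : Str := [116, 111, 107, 101, 110, 95, 101, 112]
def jwks_uri : Str := [106, 119, 107, 115, 95, 117, 114, 105]
def reg_ep : Str := [114, 101, 103, 95, 101, 112]
def resource : Str := [114, 101, 115, 111, 117, 114, 99, 101]
def password : Str := [112, 97, 115, 115, 119, 111, 114, 100]
def ok : Str := [111, 107]
def access_tokens : Str := [97, 99, 99, 101, 115, 115, 95, 116, 111, 107, 101, 110, 115]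

end K

/-! # Message formats -/

section Formats

variable {A N V : Type}

/-- `⟨⟩` -/
abbrev nil : Term A N V := .seq []

def url (protocol host path parameters fragment : Term A N V) : Term A N V :=
  .seq [K.URL, protocol, host, path, parameters, fragment]

def httpReq (nonce method host path parameters headers body : Term A N V) : Term A N V :=
  .seq [K.HTTPReq, nonce, method, host, path, parameters, headers, body]

def httpResp (nonce status headers body : Term A N V) : Term A N V :=
  .seq [K.HTTPResp, nonce, status, headers, body]

end Formats

/-! Names of the components of URLs, HTTP requests (prefix `q`), HTTP responses (prefix `p`),
DNS responses (prefix `d`), and identities (prefix `i`). -/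

namespace Term

variable {A N V : Type}

noncomputable section

def protocol (t : Term A N V) := comp t 2
def host (t : Term A N V) := comp t 3
def path (t : Term A N V) := comp t 4
def parameters (t : Term A N V) := comp t 5
def fragment (t : Term A N V) := comp t 6

def qnonce (t : Term A N V) := comp t 2
def qmethod (t : Term A N V) := comp t 3
def qhost (t : Term A N V) := comp t 4
def qpath (t : Term A N V) := comp t 5
def qparameters (t : Term A N V) := comp t 6
def qheaders (t : Term A N V) := comp t 7
def qbody (t : Term A N V) := comp t 8

def pnonce (t : Term A N V) := comp t 2
def pstatus (t : Term A N V) := comp t 3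
def pheaders (t : Term A N V) := comp t 4
def pbody (t : Term A N V) := comp t 5

def ddomain (t : Term A N V) := comp t 2
def dresult (t : Term A N V) := comp t 3
def dnonce (t : Term A N V) := comp t 4

def idomain (t : Term A N V) := comp t 2

end

end Term

/-- DNS responses. -/
def IsDNSResponse {A N V : Type} (doms : Finset Str) (m : Term A N V) : Prop :=
  ∃ d ∈ doms, ∃ a n, m ≡ₜ .seq [K.DNSResolved, .str d, .addr a, .nonce n]

/-! # Algorithms

A nondeterministic algorithm is the set of its possible results, and is written with the `do`
notation of the monad `Set`: `let x ← M` chooses `x` from the set `M`, and there is no result if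
`M` is empty. An algorithm of a process with states in `St` results in `some (E, s)` (stop with the
output `E` and the new state `s`) or in `none` (stop without output and without a change of the
state). -/

/-- The results of an algorithm. -/
abbrev Result (A N St : Type) := Option (List (Event A (PTerm A N)) × St)

/-- The relation of a process that is given by an algorithm; `enc` represents the states as
terms. -/
def algRel {A N St : Type} (enc : St → PTerm A N)
    (alg : A → A → PTerm A N → St → Set (Result A N St))
    (e : Event A (Msg A N)) (s : Msg A N) (E : List (Event A (PTerm A N))) (s' : PTerm A N) :
    Prop :=
  ∃ σ, s.lift = enc σ ∧ ∃ o ∈ alg e.dst e.src e.msg.lift σ,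
    match o with
    | none => E = [] ∧ s' = s.lift
    | some (E₁, σ₁) => E = E₁ ∧ s' = enc σ₁

noncomputable section

open scoped Classical
attribute [local instance] Set.monad

section Servers

variable {A N : Type}

/-- Stop with the new state `s` and one output event `⟨dst, src, msg⟩`. -/
def stopWith {St : Type} (dst src msg : PTerm A N) (s : St) : Set (Result A N St) :=
  {o | ∃ a b, dst ≡ₜ .addr a ∧ src ≡ₜ .addr b ∧ o = some ([⟨a, b, msg⟩], s)}

/-! ## Generic HTTPS servers -/

/-- States of HTTPS servers; `app` consists of the components of the concrete server. -/
structure ServerState (A N X : Type) where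
  DNSaddress : PTerm A N
  pendingDNS : PTerm A N
  pendingRequests : PTerm A N
  corrupt : PTerm A N
  keyMapping : PTerm A N
  tlskeys : PTerm A N
  app : X

/-- The algorithms of a concrete HTTPS server. The default trigger handler is used by all servers
here. -/
structure Server (A N X : Type) where
  appTerms : X → List (PTerm A N)
  processRequest : (m k : PTerm A N) → (a f : A) → ServerState A N X →
    Set (Result A N (ServerState A N X))
  processResponse : (m reference request key : PTerm A N) → (a f : A) → ServerState A N X →
    Set (Result A N (ServerState A N X))
  processOther : (m : PTerm A N) → (a f : A) → ServerState A N X →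
    Set (Result A N (ServerState A N X))

def Server.toTerm {X : Type} (srv : Server A N X) (s : ServerState A N X) : PTerm A N :=
  .seq ([s.DNSaddress, s.pendingDNS, s.pendingRequests, s.corrupt, s.keyMapping, s.tlskeys] ++
    srv.appTerms s.app)

/-- The placeholders of the generic server, not used by the concrete servers. -/
def νn0 : PTerm A N := .var 8
def νn1 : PTerm A N := .var 9

/-- `HTTPS_SIMPLE_SEND`; `a` is the receiver of the event that is being handled. -/
def simpleSend {X : Type} (reference message : PTerm A N) (a : A) (s : ServerState A N X) :
    Set (Result A N (ServerState A N X)) := do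
  let pendingDNS ← update s.pendingDNS νn0 (.seq [reference, message])
  stopWith s.DNSaddress (.addr a) (.seq [K.DNSResolve, message.qhost, νn0])
    { s with pendingDNS := pendingDNS }

/-- The main algorithm of a generic HTTPS server. -/
def serverMain {X : Type} (doms : Finset Str) (srv : Server A N X) (a f : A) (m : PTerm A N)
    (s : ServerState A N X) : Set (Result A N (ServerState A N X)) := do
  if ¬ s.corrupt ≡ₜ .bot ∨ m ≡ₜ K.CORRUPT then
    let s' := { s with corrupt := .seq [.seq [.addr a, .addr f, m], s.corrupt] }
    let m' ← derivable {srv.toTerm s'}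
    let a' ← (Set.univ : Set A)
    return some ([⟨a', a, m'⟩], s')
  else if ∃ inDomain k', .seq [inDomain, k'] ∈ elems s.tlskeys ∧ IsPair (.dec m k') then
    let ⟨inDomain, k'⟩ ← ({x | .seq [x.1, x.2] ∈ elems s.tlskeys ∧ IsPair (.dec m x.2)} :
      Set (PTerm A N × PTerm A N))
    let mdec := comp (.dec m k') 1
    let k := comp (.dec m k') 2
    if ¬ ∃ n method path parameters headers body,
        httpReq n method inDomain path parameters headers body ≡ₜ mdec then
      return none
    else
      srv.processRequest mdec k a f s
  else if IsDNSResponse doms m then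
    if ¬ HasKey s.pendingDNS m.dnonce then
      return none
    else
      let entry ← lookup s.pendingDNS m.dnonce
      let reference := comp entry 1
      let request := comp entry 2
      if ¬ IsAddr m.dresult ∨ ¬ m.ddomain ≡ₜ request.qhost then
        return none
      else
        let pendingRequests := snoc s.pendingRequests (.seq [reference, request, νn1, m.dresult])
        let key ← lookup s.keyMapping request.qhost
        let pendingDNS ← removeKey s.pendingDNS m.dnonce
        stopWith m.dresult (.addr a) (.enc (.seq [request, νn1]) key)
          { s with pendingDNS := pendingDNS, pendingRequests := pendingRequests }
  else if ∃ reference request key f', .seq [reference, request, key, f'] ∈ elems s.pendingRequests ∧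
      comp (.decs m key) 1 ≡ₜ K.HTTPResp then
    let ⟨reference, request, key, f'⟩ ← ({x | .seq [x.1, x.2.1, x.2.2.1, x.2.2.2] ∈
      elems s.pendingRequests ∧ comp (.decs m x.2.2.1) 1 ≡ₜ K.HTTPResp} :
      Set (PTerm A N × PTerm A N × PTerm A N × PTerm A N))
    let m' := (Term.decs m key).nf
    if ¬ m'.pnonce ≡ₜ request.qnonce then
      return none
    else
      let pendingRequests ← removeElem s.pendingRequests (.seq [reference, request, key, f'])
      srv.processResponse m' reference request key a f
        { s with pendingRequests := pendingRequests }
  else if m ≡ₜ K.TRIGGER then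
    return none
  else
    srv.processOther m a f s

/-- The process of an HTTPS server with the given addresses and initial state. -/
def serverProcess {X : Type} (doms : Finset Str) (srv : Server A N X) (addrs : Set A)
    (init : Msg A N) : AtomicProcess A N :=
  ⟨addrs, algRel srv.toTerm (serverMain doms srv), init⟩

/-! ## Relying parties -/

structure RPApp (A N : Type) where
  sessions : PTerm A N
  issuerCache : PTerm A N
  oidcConfigCache : PTerm A N
  jwksCache : PTerm A N
  clientCredentialsCache : PTerm A N

abbrev RPState (A N : Type) := ServerState A N (RPApp A N)

abbrev RPResult (A N : Type) := Result A N (RPState A N)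

/-- `START_LOGIN_FLOW`; `dr` is the set of the domains of the relying party. -/
def startLoginFlow (dr : Finset Str) (sessionId : PTerm A N) (a : A) (s : RPState A N) :
    Set (RPResult A N) := do
  let redirectUris : Set (PTerm A N) :=
    {u | ∃ d ∈ dr, u = url K.HTTPS (.str d) K.pRedirectEp nil nil}
  let session ← lookup s.app.sessions sessionId
  let identity ← lookup session K.identity
  if ¬ HasKey s.app.issuerCache identity then
    let message := httpReq (.var 5) K.GET identity.idomain K.pWebfinger
      (dict [(K.resource, identity)]) nil nil
    simpleSend (dict [(K.responseTo, K.WEBFINGER), (K.session, sessionId)]) message a s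
  else
  let issuer ← lookup s.app.issuerCache identity
  if ¬ HasKey s.app.oidcConfigCache issuer then
    let message := httpReq (.var 5) K.GET issuer K.pConfig nil nil nil
    simpleSend (dict [(K.responseTo, K.CONFIG), (K.session, sessionId)]) message a s
  else
  let oidcConfig ← lookup s.app.oidcConfigCache issuer
  if ¬ HasKey s.app.jwksCache issuer then
    let u ← lookup oidcConfig K.jwks_uri
    let message := httpReq (.var 5) K.GET u.host u.path nil nil nil
    simpleSend (dict [(K.responseTo, K.JWKS), (K.session, sessionId)]) message a s
  else
  if ¬ HasKey s.app.clientCredentialsCache issuer then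
    let u ← lookup oidcConfig K.reg_ep
    let uris ← seqOf redirectUris
    let message := httpReq (.var 5) K.POST u.host u.path nil nil (dict [(K.redirect_uris, uris)])
    simpleSend (dict [(K.responseTo, K.REGISTRATION), (K.session, sessionId)]) message a s
  else
  let credentials ← lookup s.app.clientCredentialsCache issuer
  let responseType ← ({.seq [K.code], .seq [K.id_token], .seq [K.id_token, K.token],
    .seq [K.code, K.id_token], .seq [K.code, K.token], .seq [K.code, K.id_token, K.token]} :
    Set (PTerm A N))
  let redirectUri ← redirectUris
  let clientId ← lookup credentials K.client_id
  let data₀ := dict [(K.response_type, responseType), (K.redirect_uri, redirectUri),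
    (K.client_id, clientId), (K.state, .var 6)]
  let data ← if ¬ Mem K.code responseType then update data₀ K.nonce (.var 7)
    else ({data₀} : Set (PTerm A N))
  let sessions ← update s.app.sessions sessionId (union session data)
  let authEndpoint ← lookup oidcConfig K.auth_ep
  let authEndpoint' := setAt authEndpoint [5] (union authEndpoint.parameters data)
  let headers ← update (dict [(K.Location, authEndpoint'), (K.ReferrerPolicy, K.origin)])
    K.SetCookie (dict [(K.sessionId, .seq [sessionId, .top, .top, .top])])
  let session' ← lookup sessions sessionId
  let request ← lookup session' K.startRequest
  let message ← lookup request K.message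
  let key ← lookup request K.key
  let sender ← lookup request K.sender
  let receiver ← lookup request K.receiver
  let m' := Term.encs (httpResp message.qnonce K.s303 headers .bot) key
  stopWith sender receiver m' { s with app.sessions := sessions }

/-- `SEND_TOKEN_REQUEST` -/
def sendTokenRequest (sessionId code : PTerm A N) (a : A) (s : RPState A N) : Set (RPResult A N) := do
  let session ← lookup s.app.sessions sessionId
  let identity ← lookup session K.identity
  let issuer ← lookup s.app.issuerCache identity
  let credentials ← lookup s.app.clientCredentialsCache issuer
  let redirectUri ← lookup session K.redirect_uri
  let body₀ := dict [(K.grant_type, K.authorization_code), (K.code, code),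
    (K.redirect_uri, redirectUri)]
  let clientId ← lookup credentials K.client_id
  let clientSecret ← lookup credentials K.client_secret
  let body ← if clientSecret ≡ₜ nil then update body₀ K.client_id clientId
    else ({body₀} : Set (PTerm A N))
  let headers := if clientSecret ≡ₜ nil then nil
    else dict [(K.Authorization, .seq [clientId, clientSecret])]
  let config ← lookup s.app.oidcConfigCache issuer
  let u ← lookup config K.token_ep
  let message := httpReq (.var 2) K.POST u.host u.path u.parameters headers body
  simpleSend (dict [(K.responseTo, K.TOKEN), (K.session, sessionId)]) message a s

/-- `USE_ACCESS_TOKEN` -/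
def useAccessToken (sessionId token : PTerm A N) (a : A) (s : RPState A N) : Set (RPResult A N) := do
  let session ← lookup s.app.sessions sessionId
  let identity ← lookup session K.identity
  let issuer ← lookup s.app.issuerCache identity
  let headers := dict [(K.Authorization, .seq [K.Bearer, token])]
  let config ← lookup s.app.oidcConfigCache issuer
  let u ← lookup config K.token_ep
  let path ← (Set.univ : Set Str)
  let message := httpReq (.var 3) K.POST u.host (.str path) u.parameters headers nil
  simpleSend (dict [(K.responseTo, K.RESOURCE_USAGE), (K.session, sessionId)]) message a s

/-- `CHECK_ID_TOKEN` -/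
def checkIdToken (sessionId idToken : PTerm A N) (s : RPState A N) : Set (RPResult A N) := do
  let session ← lookup s.app.sessions sessionId
  let identity ← lookup session K.identity
  let issuer ← lookup s.app.issuerCache identity
  let credentials ← lookup s.app.clientCredentialsCache issuer
  let jwks ← lookup s.app.jwksCache issuer
  let data := (Term.extractmsg idToken).nf
  let iss ← lookup data K.iss
  let aud ← lookup data K.aud
  let clientId ← lookup credentials K.client_id
  let dataNonce ← lookup data K.nonce
  let sessionNonce ← lookup session K.nonce
  let sub ← lookup data K.sub
  if ¬ iss ≡ₜ issuer then return none
  else if ¬ aud ≡ₜ clientId then return none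
  else if ¬ Term.checksig idToken jwks ≡ₜ .top then return none
  else if HasKey session K.nonce ∧ ¬ dataNonce ≡ₜ sessionNonce then return none
  else
  let session₁ ← update session K.loggedInAs (.seq [issuer, sub])
  let session₂ ← update session₁ K.serviceSessionId (.var 4)
  let sessions ← update s.app.sessions sessionId session₂
  let request ← lookup session K.redirectEpRequest
  let headers ← update (dict [(K.ReferrerPolicy, K.origin)]) K.SetCookie
    (dict [(K.serviceSessionId, .seq [.var 4, .top, .top, .top])])
  let message ← lookup request K.message
  let key ← lookup request K.key
  let sender ← lookup request K.sender
  let receiver ← lookup request K.receiver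
  let m' := Term.encs (httpResp message.qnonce K.s200 headers K.ok) key
  stopWith sender receiver m' { s with app.sessions := sessions }

/-- `PROCESS_HTTPS_RESPONSE` of a relying party. -/
def rpResponse (dr : Finset Str) (m reference _request _key : PTerm A N) (a _f : A)
    (s : RPState A N) : Set (RPResult A N) := do
  let sessionId ← lookup reference K.session
  let session ← lookup s.app.sessions sessionId
  let id ← lookup session K.identity
  let issuer ← lookup s.app.issuerCache id
  let responseTo ← lookup reference K.responseTo
  if responseTo ≡ₜ K.WEBFINGER then
    let subject ← lookup m.pbody K.subject
    let links ← lookup m.pbody K.links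
    let rel ← lookup links K.rel
    let href ← lookup links K.href
    if ¬ subject ≡ₜ id then return none
    else if ¬ rel ≡ₜ K.OIDC_issuer then return none
    else
    let issuerCache ← update s.app.issuerCache id href
    startLoginFlow dr sessionId a { s with app.issuerCache := issuerCache }
  else if responseTo ≡ₜ K.CONFIG then
    let configIssuer ← lookup m.pbody K.issuer
    if ¬ configIssuer ≡ₜ issuer then return none
    else
    let oidcConfigCache ← update s.app.oidcConfigCache issuer m.pbody
    startLoginFlow dr sessionId a { s with app.oidcConfigCache := oidcConfigCache }
  else if responseTo ≡ₜ K.JWKS then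
    let jwksCache ← update s.app.jwksCache issuer m.pbody
    startLoginFlow dr sessionId a { s with app.jwksCache := jwksCache }
  else if responseTo ≡ₜ K.REGISTRATION then
    let cache ← update s.app.clientCredentialsCache issuer m.pbody
    startLoginFlow dr sessionId a { s with app.clientCredentialsCache := cache }
  else if responseTo ≡ₜ K.TOKEN then
    let useAccessTokenNow ← (Set.univ : Set Bool)
    let responseType ← lookup session K.response_type
    let accessToken ← lookup m.pbody K.access_token
    let idToken ← lookup m.pbody K.id_token
    if Mem K.token responseType ∧ useAccessTokenNow = true then
      useAccessToken sessionId accessToken a s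
    else
      checkIdToken sessionId idToken s
  else
    return none

/-- `PROCESS_HTTPS_REQUEST` of a relying party. -/
def rpRequest (dr : Finset Str) (m k : PTerm A N) (a f : A) (s : RPState A N) :
    Set (RPResult A N) := do
  let origin ← lookup m.qheaders K.Origin
  let requestRecord := dict [(K.message, m), (K.key, k), (K.receiver, .addr a),
    (K.sender, .addr f)]
  if m.qpath ≡ₜ K.pRoot then
    let m' := Term.encs (httpResp m.qnonce K.s200 (dict [(K.ReferrerPolicy, K.origin)])
      (.seq [K.script_rp_index, nil])) k
    stopWith (.addr f) (.addr a) m' s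
  else if m.qpath ≡ₜ K.pStartLogin ∧ m.qmethod ≡ₜ K.POST then
    if ¬ origin ≡ₜ .seq [m.qhost, K.HTTPS] then return none
    else
    let sessions ← update s.app.sessions (.var 1)
      (dict [(K.startRequest, requestRecord), (K.identity, m.qbody)])
    startLoginFlow dr (.var 1) a { s with app.sessions := sessions }
  else if m.qpath ≡ₜ K.pRedirectEp then
    let cookie ← lookup m.qheaders K.Cookie
    let sessionId ← lookup cookie K.sessionId
    if ¬ HasKey s.app.sessions sessionId then return none
    else
    let session ← lookup s.app.sessions sessionId
    let identity ← lookup session K.identity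
    let issuer ← lookup s.app.issuerCache identity
    let iss ← lookup m.qparameters K.iss
    if ¬ iss ≡ₜ issuer then return none
    else
    let responseType ← lookup session K.response_type
    if ¬ responseType ≡ₜ .seq [K.code] ∧ m.qmethod ≡ₜ K.GET then
      let m' := Term.encs (httpResp m.qnonce K.s200 (dict [(K.ReferrerPolicy, K.origin)])
        (.seq [K.script_rp_get_fragment, .bot])) k
      stopWith (.addr f) (.addr a) m' s
    else
    let data := if responseType ≡ₜ .seq [K.code] then m.qparameters else m.qbody
    let dataState ← lookup data K.state
    let sessionState ← lookup session K.state
    if ¬ dataState ≡ₜ sessionState then return none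
    else
    let session' ← update session K.redirectEpRequest requestRecord
    let sessions ← update s.app.sessions sessionId session'
    let s' := { s with app.sessions := sessions }
    let idToken ← lookup data K.id_token
    let accessToken ← lookup m.qbody K.access_token
    let code ← lookup m.qbody K.code
    let checkIdTokenNow ← if Mem K.code responseType then (Set.univ : Set Bool)
      else ({true} : Set Bool)
    let useAccessTokenNow ← (Set.univ : Set Bool)
    if Mem K.id_token responseType ∧ checkIdTokenNow = true then
      checkIdToken sessionId idToken s'
    else if Mem K.token responseType ∧ useAccessTokenNow = true then
      useAccessToken sessionId accessToken a s'
    else if Mem K.code responseType then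
      sendTokenRequest sessionId code a s'
    else
      return none
  else
    return none

/-- The relying party with the set `dr` of domains. -/
def rpServer (dr : Finset Str) : Server A N (RPApp A N) where
  appTerms x := [x.sessions, x.issuerCache, x.oidcConfigCache, x.jwksCache,
    x.clientCredentialsCache]
  processRequest := rpRequest dr
  processResponse := rpResponse dr
  processOther _ _ _ _ := {none}

/-! ## Identity providers -/

structure IdPApp (A N : Type) where
  registrationRequests : PTerm A N
  clients : PTerm A N
  records : PTerm A N
  jwk : PTerm A N

abbrev IdPState (A N : Type) := ServerState A N (IdPApp A N)

abbrev IdPResult (A N : Type) := Result A N (IdPState A N)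

/-- The terms that represent identities. -/
def idTerm {V : Type} (id : Str × Str) : Term A N V := .seq [.str id.1, .str id.2]

/-- The dictionary entries `l` if `c` holds, and no entries otherwise. -/
def entriesIf (c : Prop) (l : List (PTerm A N × PTerm A N)) : List (PTerm A N × PTerm A N) :=
  if c then l else []

/-- The part of the request handler of an identity provider that serves the path `/auth2`;
`IsPassword` relates the identities of the system to their passwords. -/
def idpAuth2 (di : Finset Str) (IsPassword : PTerm A N → PTerm A N → Prop) (m k : PTerm A N)
    (a f : A) (s : IdPState A N) : Set (IdPResult A N) := do
  let identity ← lookup m.qbody K.identity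
  let password ← lookup m.qbody K.password
  if ¬ ∃ d ∈ di, identity.idomain ≡ₜ .str d then return none
  else if ¬ IsPassword identity password then return none
  else
  let responseType ← lookup m.qbody K.response_type
  let clientId ← lookup m.qbody K.client_id
  let redirectUri ← lookup m.qbody K.redirect_uri
  let state ← lookup m.qbody K.state
  let nonce ← lookup m.qbody K.nonce
  if ¬ HasKey s.app.clients clientId then return none
  else
  let clientInfo ← lookup s.app.clients clientId
  let redirectUris ← lookup clientInfo K.redirect_uris
  if ¬ Mem redirectUri redirectUris then return none
  else
  let record := dict [(K.client_id, clientId), (K.redirect_uri, redirectUri),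
    (K.subject, identity), (K.issuer, m.qhost), (K.nonce, nonce), (K.code, .var 1),
    (K.access_tokens, .seq [.var 2, .var 3])]
  let s' := { s with app.records := snoc s.app.records record }
  let idTokenBody := dict [(K.iss, m.qhost), (K.sub, identity), (K.aud, clientId),
    (K.nonce, nonce)]
  let responseData := dict (
    entriesIf (Mem K.code responseType) [(K.code, .var 1)] ++
    entriesIf (Mem K.token responseType) [(K.access_token, .var 2), (K.token_type, K.bearer)] ++
    entriesIf (Mem K.id_token responseType) [(K.id_token, .sig idTokenBody s.app.jwk)] ++
    entriesIf (¬ state ≡ₜ nil) [(K.state, state)])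
  if ¬ responseType ≡ₜ .seq [K.code] ∧ ¬ Mem K.code responseType ∧
      Mem K.id_token responseType ∧ nonce ≡ₜ nil then return none
  else
  let uri₁ := if responseType ≡ₜ .seq [K.code] then
      setAt redirectUri [5] (union redirectUri.parameters responseData)
    else setAt redirectUri [6] (union redirectUri.fragment responseData)
  let parameters ← update uri₁.parameters K.iss m.qhost
  let uri₂ := setAt uri₁ [5] parameters
  let m' := Term.encs (httpResp m.qnonce K.s303 (dict [(K.Location, uri₂)]) nil) k
  stopWith (.addr f) (.addr a) m' s'

/-- The part of the request handler of an identity provider that serves the path `/token`. -/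
def idpToken (m k : PTerm A N) (a f : A) (s : IdPState A N) : Set (IdPResult A N) := do
  let bodyId ← lookup m.qbody K.client_id
  let authorization ← lookup m.qheaders K.Authorization
  let clientId := if HasKey m.qbody K.client_id then bodyId else comp authorization 1
  let clientSecret := if HasKey m.qbody K.client_id then nil else comp authorization 2
  let clientInfo ← lookup s.app.clients clientId
  let storedSecret ← lookup clientInfo K.client_secret
  let redirectUris ← lookup clientInfo K.redirect_uris
  if clientInfo ≡ₜ nil ∨ ¬ storedSecret ≡ₜ clientSecret then return none
  else
  let code ← lookup m.qbody K.code
  if ¬ ∃ j recordCode, j ∈ Finset.Icc 1 (elems s.app.records).length ∧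
      recordCode ∈ lookup (comp s.app.records j) K.code ∧ recordCode ≡ₜ code ∧
      ¬ code ≡ₜ .bot then return none
  else
  let ptr ← {j | j ∈ Finset.Icc 1 (elems s.app.records).length ∧
    ∃ recordCode ∈ lookup (comp s.app.records j) K.code, recordCode ≡ₜ code ∧ ¬ code ≡ₜ .bot}
  let record := comp s.app.records ptr
  let recordId ← lookup record K.client_id
  let recordUri ← lookup record K.redirect_uri
  let bodyUri ← lookup m.qbody K.redirect_uri
  if ¬ recordId ≡ₜ clientId then return none
  else if ¬ (recordUri ≡ₜ bodyUri ∨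
      ((elems redirectUris).length = 1 ∧ ¬ HasKey m.qbody K.redirect_uri)) then return none
  else
  let record' ← update record K.code .bot
  let s' := { s with app.records := setAt s.app.records [ptr] record' }
  let accessTokenChoice ← ({1, 2} : Set ℕ)
  let accessTokens ← lookup record K.access_tokens
  let issuer ← lookup record K.issuer
  let subject ← lookup record K.subject
  let nonce ← lookup record K.nonce
  let idTokenBody := dict [(K.iss, issuer), (K.sub, subject), (K.aud, recordId), (K.nonce, nonce)]
  let m' := Term.encs (httpResp m.qnonce K.s200 nil
    (dict [(K.access_token, comp accessTokens accessTokenChoice), (K.token_type, K.bearer),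
      (K.id_token, .sig idTokenBody s.app.jwk)])) k
  stopWith (.addr f) (.addr a) m' s'

/-- `PROCESS_HTTPS_REQUEST` of an identity provider with the set `di` of domains; `ids` is the set
of the identities that it governs. -/
def idpRequest (di : Finset Str) (ids : Set (Str × Str))
    (IsPassword : PTerm A N → PTerm A N → Prop) (m k : PTerm A N) (a f : A) (s : IdPState A N) :
    Set (IdPResult A N) := do
  let origin ← lookup m.qheaders K.Origin
  if m.qpath ≡ₜ K.pWebfinger then
    let resource ← lookup m.qparameters K.resource
    if ¬ ∃ id ∈ ids, idTerm id ≡ₜ resource then return none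
    else
    let descriptor := dict [(K.subject, resource),
      (K.links, dict [(K.rel, K.OIDC_issuer), (K.href, m.qhost)])]
    stopWith (.addr f) (.addr a) (.encs (httpResp m.qnonce K.s200 nil descriptor) k) s
  else if m.qpath ≡ₜ K.pConfig then
    let metaData := dict [(K.issuer, m.qhost),
      (K.auth_ep, url K.HTTPS m.qhost K.pAuth nil nil),
      (K.token_ep, url K.HTTPS m.qhost K.pToken nil nil),
      (K.jwks_uri, url K.HTTPS m.qhost K.pJwks nil nil),
      (K.reg_ep, url K.HTTPS m.qhost K.pReg nil nil)]
    stopWith (.addr f) (.addr a) (.encs (httpResp m.qnonce K.s200 nil metaData) k) s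
  else if m.qpath ≡ₜ K.pJwks then
    stopWith (.addr f) (.addr a) (.encs (httpResp m.qnonce K.s201 nil (.pub s.app.jwk)) k) s
  else if m.qpath ≡ₜ K.pReg ∧ m.qmethod ≡ₜ K.POST then
    let requests := snoc s.app.registrationRequests (.seq [m, k, .addr a, .addr f])
    return some ([], { s with app.registrationRequests := requests })
  else if m.qpath ≡ₜ K.pAuth then
    if ¬ m.qmethod ≡ₜ K.GET ∧ ¬ m.qmethod ≡ₜ K.POST then return none
    else
    let data := if m.qmethod ≡ₜ K.GET then m.qparameters else m.qbody
    let m' := Term.encs (httpResp m.qnonce K.s200 (dict [(K.ReferrerPolicy, K.origin)])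
      (.seq [K.script_idp_form, data])) k
    stopWith (.addr f) (.addr a) m' s
  else if m.qpath ≡ₜ K.pAuth2 ∧ m.qmethod ≡ₜ K.POST ∧ origin ≡ₜ .seq [m.qhost, K.HTTPS] then
    idpAuth2 di IsPassword m k a f s
  else if m.qpath ≡ₜ K.pToken ∧ m.qmethod ≡ₜ K.POST then
    idpToken m k a f s
  else
    return none

/-- The part of `PROCESS_OTHER` of an identity provider that issues the client id `clientId` in
response to the stored registration request `⟨m, k, a, f⟩`. -/
def idpRegister (clientId m k a f : PTerm A N) (s : IdPState A N) : Set (IdPResult A N) := do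
  let registrationRequests ← removeElem s.app.registrationRequests (.seq [m, k, a, f])
  let redirectUris ← lookup m.qbody K.redirect_uris
  let issueSecret ← (Set.univ : Set Bool)
  let regResponse := if issueSecret = true then
      dict [(K.client_id, clientId), (K.client_secret, .var 4)]
    else dict [(K.client_id, clientId)]
  let clientInfo ← update regResponse K.redirect_uris redirectUris
  let clients ← update s.app.clients clientId clientInfo
  stopWith f a (.encs (httpResp m.qnonce K.s201 nil regResponse) k)
    { s with app := { s.app with registrationRequests := registrationRequests, clients := clients } }

/-- `PROCESS_OTHER` of an identity provider. -/
def idpOther (clientId : PTerm A N) (s : IdPState A N) : Set (IdPResult A N) := do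
  if HasKey s.app.clients clientId then return none
  else if ¬ ∃ m k a f, .seq [m, k, a, f] ∈ elems s.app.registrationRequests then return none
  else
  let ⟨m, k, a, f⟩ ← ({x | .seq [x.1, x.2.1, x.2.2.1, x.2.2.2] ∈
    elems s.app.registrationRequests} : Set (PTerm A N × PTerm A N × PTerm A N × PTerm A N))
  idpRegister clientId m k a f s

/-- The identity provider with the set `di` of domains. -/
def idpServer (di : Finset Str) (ids : Set (Str × Str))
    (IsPassword : PTerm A N → PTerm A N → Prop) : Server A N (IdPApp A N) where
  appTerms x := [x.registrationRequests, x.clients, x.records, x.jwk]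
  processRequest := idpRequest di ids IsPassword
  processResponse _ _ _ _ _ _ _ := {none}
  processOther m _ _ s := idpOther m s

/-! ## DNS servers -/

/-- The relation of a DNS server with the table `tbl`. -/
def dnsRel (doms : Finset Str) (tbl : List (Str × A)) (e : Event A (Msg A N)) (s : Msg A N)
    (E : List (Event A (PTerm A N))) (s' : PTerm A N) : Prop :=
  s' = s.lift ∧
  ((∃ d ∈ doms, ∃ b n, (d, b) ∈ tbl ∧ e.msg ≡ₜ .seq [K.DNSResolve, .str d, .nonce n] ∧
      E = [⟨e.src, e.dst, .seq [K.DNSResolved, .str d, .addr b, .nonce n]⟩]) ∨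
   ((¬ ∃ d ∈ doms, ∃ b n, (d, b) ∈ tbl ∧ e.msg ≡ₜ .seq [K.DNSResolve, .str d, .nonce n]) ∧
      E = []))

end Servers
/-! ## Scripts -/

section Scripts

variable {A N : Type}

/-- Scripts. In the outputs, the variable with index `i` stands for `λ_i`. -/
abbrev Script (A N : Type) := Msg A N → Set (PTerm A N)

/-- `⟨tree, docnonce, scriptstate, scriptinputs, cookies, localStorage, sessionStorage, ids,
secrets⟩` -/
def scriptInput {V : Type} (tree docnonce scriptstate scriptinputs cookies localStorage
    sessionStorage ids secrets : Term A N V) : Term A N V :=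
  .seq [tree, docnonce, scriptstate, scriptinputs, cookies, localStorage, sessionStorage, ids,
    secrets]

/-- The subwindows of a document or of a limited document. -/
def docSubwindows {V : Type} (d : Term A N V) : Term A N V :=
  if (elems d).length = 2 then comp d 2 else comp d 8

/-- The documents in a tree of windows and documents. -/
inductive DocIn {V : Type} (tree : Term A N V) : Term A N V → Prop
  | top {w d} : w ∈ elems tree → d ∈ elems (comp w 2) → DocIn tree d
  | sub {d w d'} : DocIn tree d → w ∈ elems (docSubwindows d) → d' ∈ elems (comp w 2) →
      DocIn tree d'

/-- `GETURL` -/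
def getURL {V : Type} (tree docnonce : Term A N V) : Set (Term A N V) :=
  {u | (∃ d, DocIn tree d ∧ comp d 1 ≡ₜ docnonce ∧ u = comp d 2) ∨
    ((¬ ∃ d, DocIn tree d ∧ comp d 1 ≡ₜ docnonce) ∧ u = .undef)}

/-- The dictionaries over strings and strings. -/
def stringDicts {V : Type} : Set (Term A N V) :=
  {t | ∃ l : List (Str × Str), t = dict (l.map fun p => (.str p.1, .str p.2))}

/-- The attacker script. -/
def attackerScript : Script A N := fun input => derivable {input.lift}

/-- `script_rp_index` -/
def scriptRpIndex (doms : Finset Str) : Script A N := fun input => do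
  let t : PTerm A N := input.lift
  let out (command : PTerm A N) : PTerm A N :=
    .seq [comp t 3, comp t 5, comp t 6, comp t 7, command]
  let auth ← (Set.univ : Set Bool)
  if auth = true then
    let u ← getURL (comp t 1) (comp t 2)
    let id ← {x | x ∈ elems (comp t 8)}
    let u' := url K.HTTPS u.host K.pStartLogin nil nil
    return out (.seq [K.FORM, u', K.POST, id, .bot])
  else
    let protocol ← ({K.HTTP, K.HTTPS} : Set Str)
    let host ← {x | x ∈ doms}
    let path ← (Set.univ : Set Str)
    let fragment ← (Set.univ : Set Str)
    let parameters ← stringDicts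
    let u := url (.str protocol) (.str host) (.str path) parameters (.str fragment)
    return out (.seq [K.HREF, u, .bot, .bot])

/-- `script_rp_get_fragment` -/
def scriptRpGetFragment : Script A N := fun input => do
  let t : PTerm A N := input.lift
  let u ← getURL (comp t 1) (comp t 2)
  let iss ← lookup u.parameters K.iss
  let u' := url K.HTTPS u.host K.pRedirectEp (dict [(K.iss, iss)]) nil
  return .seq [comp t 3, comp t 5, comp t 6, comp t 7, .seq [K.FORM, u', K.POST, u.fragment, .bot]]

/-- `script_idp_form` -/
def scriptIdpForm : Script A N := fun input => do
  let t : PTerm A N := input.lift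
  let u ← getURL (comp t 1) (comp t 2)
  let u' := url K.HTTPS u.host K.pAuth2 nil nil
  let identity ← {x | x ∈ elems (comp t 8)}
  let secret ← {x | x ∈ elems (comp t 9)}
  let formData₁ ← update (comp t 3) K.identity identity
  let formData₂ ← update formData₁ K.password secret
  return .seq [comp t 3, comp t 5, comp t 6, comp t 7, .seq [K.FORM, u', K.POST, formData₂, .bot]]

/-- The inverse of the mapping `script`: the scripts with a given string representation. -/
def scriptsOf (doms : Finset Str) (name : Str) : Set (Script A N) :=
  {R | (name = K.att_script ∧ R = attackerScript) ∨
    (name = K.script_rp_index ∧ R = scriptRpIndex doms) ∨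
    (name = K.script_rp_get_fragment ∧ R = scriptRpGetFragment) ∨
    (name = K.script_idp_form ∧ R = scriptIdpForm)}

end Scripts

/-! ## Web browsers

A window is a term `⟨nonce, documents, opener⟩`, a document is a term `⟨nonce, location, headers,
referrer, script, scriptstate, scriptinputs, subwindows, active⟩`, and a cookie is a term
`⟨name, ⟨value, secure, session, httpOnly⟩⟩`. Pointers to windows and documents are taken relative
to the component `windows` of the state. -/

section Browser

variable {A N : Type}

structure BrowserState (A N : Type) where
  windows : PTerm A N
  ids : PTerm A N
  secrets : PTerm A N
  cookies : PTerm A N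
  localStorage : PTerm A N
  sessionStorage : PTerm A N
  keyMapping : PTerm A N
  sts : PTerm A N
  DNSaddress : PTerm A N
  pendingDNS : PTerm A N
  pendingRequests : PTerm A N
  isCorrupted : PTerm A N

abbrev BResult (A N : Type) := Result A N (BrowserState A N)

def BrowserState.toTerm (s : BrowserState A N) : PTerm A N :=
  .seq [s.windows, s.ids, s.secrets, s.cookies, s.localStorage, s.sessionStorage, s.keyMapping,
    s.sts, s.DNSaddress, s.pendingDNS, s.pendingRequests, s.isCorrupted]

/-- `s.p` for a pointer `p` to a window or document. -/
def BrowserState.get (s : BrowserState A N) (p : List ℕ) : PTerm A N := at' s.windows p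

/-- `s.p := v` for a pointer `p` to a window or document. -/
def BrowserState.set (s : BrowserState A N) (p : List ℕ) (v : PTerm A N) : BrowserState A N :=
  { s with windows := setAt s.windows p v }

/-- The pointers to the active document of the window at `w`. -/
def activePtr (s : BrowserState A N) (w : List ℕ) : Set (List ℕ) :=
  {d | ∃ j ∈ Finset.Icc 1 (elems (s.get (w ++ [2]))).length, d = w ++ [2, j] ∧
    s.get (d ++ [9]) ≡ₜ .top}

/-- The active document of the window `w` (`⟨⟩` if there is none). -/
def activeDoc (w : PTerm A N) : Set (PTerm A N) :=
  {d | (d ∈ elems (comp w 2) ∧ comp d 9 ≡ₜ .top) ∨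
    ((¬ ∃ d' ∈ elems (comp w 2), comp d' 9 ≡ₜ .top) ∧ d = nil)}

/-- The origin of a document. -/
def docOrigin (d : PTerm A N) : PTerm A N := .seq [(comp d 2).host, (comp d 2).protocol]

/-- `Subwindows(s)` -/
inductive Subwindows (s : BrowserState A N) : List ℕ → Prop
  | top {i} : i ∈ Finset.Icc 1 (elems s.windows).length → Subwindows s [i]
  | sub {w d k} : Subwindows s w → d ∈ activePtr s w →
      k ∈ Finset.Icc 1 (elems (s.get (d ++ [8]))).length → Subwindows s (d ++ [8, k])

/-- The window `w` is a subwindow of the active document of the window `w'`. -/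
def ChildOf (w w' : PTerm A N) : Prop := ∃ d ∈ activeDoc w', Mem w (comp d 8)

/-- The active documents of two windows have the same origin. -/
def SameOrigin (w w' : PTerm A N) : Prop :=
  ∃ d ∈ activeDoc w, ∃ d' ∈ activeDoc w', docOrigin d ≡ₜ docOrigin d'

/-- `NavigableWindows(w, s)` -/
inductive Navigable (s : BrowserState A N) (w : List ℕ) : List ℕ → Prop
  | same {w'} : Subwindows s w' → SameOrigin (s.get w') (s.get w) → Navigable s w w'
  | top {w'} : Subwindows s w' → Relation.TransGen ChildOf (s.get w) (s.get w') →
      (¬ ∃ w'', Subwindows s w'' ∧ ChildOf (s.get w') (s.get w'')) → Navigable s w w'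
  | anc {w' p} : Subwindows s w' → Subwindows s p →
      Relation.TransGen ChildOf (s.get w') (s.get p) → SameOrigin (s.get p) (s.get w) →
      Navigable s w w'
  | opener {w' p} : Subwindows s w' → Subwindows s p → s.get (w' ++ [3]) ≡ₜ s.get (p ++ [1]) →
      Navigable s w p → Navigable s w w'

/-- `CleanWindow o w w'`: the window `w'` is obtained from the window `w` by removing all inactive
documents, limiting all documents with an origin other than `o`, and removing all headers. -/
inductive CleanWindow (o : PTerm A N) : PTerm A N → PTerm A N → Prop
  | empty (n docs op : PTerm A N) : (∀ d ∈ elems docs, ¬ comp d 9 ≡ₜ .top) →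
      CleanWindow o (.seq [n, docs, op]) (.seq [n, nil, op])
  | same (n docs op dn loc hd ref scr st inp subs act : PTerm A N) (subs' : List (PTerm A N)) :
      .seq [dn, loc, hd, ref, scr, st, inp, subs, act] ∈ elems docs → act ≡ₜ .top →
      .seq [loc.host, loc.protocol] ≡ₜ o → List.Forall₂ (CleanWindow o) (elems subs) subs' →
      CleanWindow o (.seq [n, docs, op])
        (.seq [n, .seq [.seq [dn, loc, nil, ref, scr, st, inp, .seq subs', act]], op])
  | limited (n docs op dn loc hd ref scr st inp subs act : PTerm A N) (subs' : List (PTerm A N)) :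
      .seq [dn, loc, hd, ref, scr, st, inp, subs, act] ∈ elems docs → act ≡ₜ .top →
      ¬ .seq [loc.host, loc.protocol] ≡ₜ o → List.Forall₂ (CleanWindow o) (elems subs) subs' →
      CleanWindow o (.seq [n, docs, op]) (.seq [n, .seq [.seq [dn, .seq subs']], op])

/-- `Clean(s, d)` -/
def clean (s : BrowserState A N) (d : PTerm A N) : Set (PTerm A N) :=
  {t | ∃ l, List.Forall₂ (CleanWindow (docOrigin d)) (elems s.windows) l ∧ t = .seq l}

def cookieName (c : PTerm A N) : PTerm A N := comp c 1
def cookieValue (c : PTerm A N) : PTerm A N := at' c [2, 1]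
def cookieSecure (c : PTerm A N) : PTerm A N := at' c [2, 2]
def cookieSession (c : PTerm A N) : PTerm A N := at' c [2, 3]
def cookieHttpOnly (c : PTerm A N) : PTerm A N := at' c [2, 4]

def IsCookie (c : PTerm A N) : Prop :=
  ∃ name value secure session httpOnly, c ≡ₜ .seq [name, .seq [value, secure, session, httpOnly]] ∧
    ∀ x ∈ [secure, session, httpOnly], x ≡ₜ .top ∨ x ≡ₜ .bot

/-- `CookieMerge(old, new)` -/
def cookieMerge (old new : PTerm A N) : Set (PTerm A N) :=
  let new₁ := (elems new).filter fun c => ¬ cookieHttpOnly c ≡ₜ .top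
  let new₂ : Set (PTerm A N) :=
    {c | ∃ l₁ l₂, new₁ = l₁ ++ c :: l₂ ∧ ∀ c' ∈ l₂, ¬ cookieName c' ≡ₜ cookieName c}
  {c | (c ∈ elems old ∧ ∀ c' ∈ new₂, ¬ cookieName c ≡ₜ cookieName c') ∨
    (c ∈ new₂ ∧ ∀ c' ∈ elems old, ¬ cookieName c ≡ₜ cookieName c') ∨
    (∃ cold ∈ elems old, ∃ cnew ∈ new₂, cookieName cold ≡ₜ cookieName cnew ∧
      c = if cookieHttpOnly cold ≡ₜ .bot then cnew else cold)}

/-- `AddCookie(old, c)` -/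
def addCookie (old c : PTerm A N) : PTerm A N :=
  .seq ((elems old).filter (fun c' => ¬ cookieName c ≡ₜ cookieName c') ++ [c])

/-- `GETNAVIGABLEWINDOW` -/
def getNavigableWindow (w : List ℕ) (window noreferrer : PTerm A N) (s : BrowserState A N) :
    Set (List ℕ × BrowserState A N) := do
  if window ≡ₜ K.BLANK then
    let opener := if noreferrer ≡ₜ .top then .bot else s.get (w ++ [1])
    return ([(elems s.windows).length + 1],
      { s with windows := snoc s.windows (.seq [.var 9, nil, opener]) })
  else if ∃ w', Navigable s w w' ∧ s.get (w' ++ [1]) ≡ₜ window then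
    let w' ← {w' | Navigable s w w' ∧ s.get (w' ++ [1]) ≡ₜ window}
    return (w', s)
  else
    return (w, s)

/-- `GETWINDOW` -/
def getWindow (w : List ℕ) (window : PTerm A N) (s : BrowserState A N) : Set (List ℕ) := do
  if ∃ w', Subwindows s w' ∧ s.get (w' ++ [1]) ≡ₜ window then
    let w' ← {w' | Subwindows s w' ∧ s.get (w' ++ [1]) ≡ₜ window}
    if SameOrigin (s.get w') (s.get w) then return w' else return w
  else
    return w

/-- `CANCELNAV` -/
def cancelNav (n : PTerm A N) (s : BrowserState A N) : BrowserState A N :=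
  { s with
    pendingRequests := .seq ((elems s.pendingRequests).filter fun x =>
      ¬ ∃ req u key f, x = .seq [n.nf, req, u, key, f])
    pendingDNS := .seq ((elems s.pendingDNS).filter fun x =>
      ¬ ∃ y message u, x = .seq [y, .seq [n.nf, message, u]]) }

/-- The sequences of the names and values of the cookies in `cookies` that satisfy `P`. -/
def cookieList (cookies : PTerm A N) (P : PTerm A N → Prop) : Set (PTerm A N) :=
  seqOf {x | ∃ c ∈ elems cookies, P c ∧ x = .seq [cookieName c, cookieValue c]}

/-- `HTTP_SEND`; `a` is the receiver of the event that is being handled. -/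
def httpSend (reference message u origin referrer referrerPolicy : PTerm A N) (a : A)
    (s : BrowserState A N) : Set (BResult A N) := do
  let u := if Mem message.qhost s.sts then setAt u [2] K.HTTPS else u
  let stored ← lookup s.cookies message.qhost
  let cookies ← cookieList stored fun c => cookieSecure c ≡ₜ .top → u.protocol ≡ₜ K.HTTPS
  let headers₁ ← update message.qheaders K.Cookie cookies
  let headers₂ ← if ¬ origin ≡ₜ .bot then update headers₁ K.Origin origin
    else ({headers₁} : Set (PTerm A N))
  let referrer₁ := if referrerPolicy ≡ₜ K.noreferrer then .bot else referrer
  let referrer₂ := if referrerPolicy ≡ₜ K.origin then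
    url referrer₁.protocol referrer₁.host K.pRoot nil .bot else referrer₁
  let headers₃ ← if ¬ referrer₁ ≡ₜ .bot then update headers₂ K.Referer (setAt referrer₂ [6] .bot)
    else ({headers₂} : Set (PTerm A N))
  let message' := setAt message [7] headers₃
  let pendingDNS ← update s.pendingDNS (.var 8) (.seq [reference, message', u])
  stopWith s.DNSaddress (.addr a) (.seq [K.DNSResolve, message'.qhost, .var 8])
    { s with pendingDNS := pendingDNS }

/-- `NAVBACK` -/
def navBack (w : List ℕ) (s : BrowserState A N) : Set (BrowserState A N) := do
  if ∃ j, 1 < j ∧ w ++ [2, j] ∈ activePtr s w then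
    let j ← {j | 1 < j ∧ w ++ [2, j] ∈ activePtr s w}
    let s' := (s.set (w ++ [2, j, 9]) .bot).set (w ++ [2, j - 1, 9]) .top
    return cancelNav (s'.get (w ++ [1])) s'
  else
    return s

/-- `NAVFORWARD` -/
def navForward (w : List ℕ) (s : BrowserState A N) : Set (BrowserState A N) := do
  if ∃ j, w ++ [2, j] ∈ activePtr s w ∧ j + 1 ≤ (elems (s.get (w ++ [2]))).length then
    let j ← {j | w ++ [2, j] ∈ activePtr s w ∧ j + 1 ≤ (elems (s.get (w ++ [2]))).length}
    let s' := (s.set (w ++ [2, j, 9]) .bot).set (w ++ [2, j + 1, 9]) .top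
    return cancelNav (s'.get (w ++ [1])) s'
  else
    return s

/-- The part of `RUNSCRIPT` that interprets the command of the script in the document at `d`. -/
def runCommand (command : PTerm A N) (w d : List ℕ) (a : A) (s : BrowserState A N) :
    Set (BResult A N) := do
  let c := comp command 1
  let len := (elems command).length
  let docPolicy ← lookup (s.get (d ++ [3])) K.ReferrerPolicy
  let origin := docOrigin (s.get d)
  let location := s.get (d ++ [2])
  if c ≡ₜ K.HREF ∧ len = 4 then
    let u := comp command 2
    let noreferrer := comp command 4
    let ⟨w', s₁⟩ ← getNavigableWindow w (comp command 3) noreferrer s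
    let req := httpReq (.var 4) K.GET u.host u.path u.parameters nil nil
    let policy := if noreferrer ≡ₜ .top then (.str K.noreferrer : PTerm A N) else docPolicy
    let n := s₁.get (w' ++ [1])
    httpSend n req u .bot location policy a (cancelNav n s₁)
  else if c ≡ₜ K.IFRAME ∧ len = 3 then
    let u := comp command 2
    let w' ← getWindow w (comp command 3) s
    let req := httpReq (.var 4) K.GET u.host u.path u.parameters nil nil
    let d' ← activePtr s w'
    let s₁ := s.set (d' ++ [8]) (snoc (s.get (d' ++ [8])) (.seq [.var 5, nil, .bot]))
    httpSend (.var 5) req u .bot (s.get (d' ++ [2])) docPolicy a s₁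
  else if c ≡ₜ K.FORM ∧ len = 5 then
    let u := comp command 2
    let method := comp command 3
    let data := comp command 4
    if ¬ method ≡ₜ K.GET ∧ ¬ method ≡ₜ K.POST then return none
    else
    let ⟨w', s₁⟩ ← getNavigableWindow w (comp command 5) .bot s
    let req := if method ≡ₜ K.GET then httpReq (.var 4) method u.host u.path data nil nil
      else httpReq (.var 4) method u.host u.path u.parameters nil data
    let origin' := if method ≡ₜ K.GET then .bot else origin
    let n := s₁.get (w' ++ [1])
    httpSend n req u origin' location docPolicy a (cancelNav n s₁)
  else if c ≡ₜ K.SETSCRIPT ∧ len = 3 then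
    let w' ← getWindow w (comp command 2) s
    let d' ← activePtr s w'
    return some ([], s.set (d' ++ [5]) (comp command 3))
  else if c ≡ₜ K.SETSCRIPTSTATE ∧ len = 3 then
    let w' ← getWindow w (comp command 2) s
    let d' ← activePtr s w'
    return some ([], s.set (d' ++ [6]) (comp command 3))
  else if c ≡ₜ K.XMLHTTPREQUEST ∧ len = 5 then
    let u := comp command 2
    let method := comp command 3
    let xhrreference := comp command 5
    if (method ≡ₜ K.CONNECT ∨ method ≡ₜ K.TRACE ∨ method ≡ₜ K.TRACK) ∧
        ¬ (IsNonce xhrreference ∨ (∃ i, xhrreference ≡ₜ .var i) ∨ xhrreference ≡ₜ .bot) then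
      return none
    else if ¬ u.host ≡ₜ comp origin 1 ∨ ¬ u.protocol ≡ₜ comp origin 2 then
      return none
    else
    let noBody := method ≡ₜ K.GET ∨ method ≡ₜ K.HEAD
    let data := if noBody then nil else comp command 4
    let origin' := if noBody then .bot else origin
    let req := httpReq (.var 4) method u.host u.path u.parameters nil data
    httpSend (.seq [s.get (d ++ [1]), xhrreference]) req u origin' location docPolicy a s
  else if c ≡ₜ K.BACK ∧ len = 2 then
    let ⟨w', s₁⟩ ← getNavigableWindow w (comp command 2) .bot s
    let s₂ ← navBack w' s₁
    return some ([], s₂)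
  else if c ≡ₜ K.FORWARD ∧ len = 2 then
    let ⟨w', s₁⟩ ← getNavigableWindow w (comp command 2) .bot s
    let s₂ ← navForward w' s₁
    return some ([], s₂)
  else if c ≡ₜ K.CLOSE ∧ len = 2 then
    let ⟨w', s₁⟩ ← getNavigableWindow w (comp command 2) .bot s
    let parent := w'.dropLast
    return some ([], s₁.set parent (.seq ((elems (s₁.get parent)).eraseIdx (w'.getLastD 1 - 1))))
  else if c ≡ₜ K.POSTMESSAGE ∧ len = 4 then
    let message := comp command 3
    let target := comp command 4
    let w' ← {w' | Subwindows s w' ∧ s.get (w' ++ [1]) ≡ₜ comp command 2}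
    if ∃ d' ∈ activePtr s w', ¬ target ≡ₜ .bot → docOrigin (s.get d') ≡ₜ target then
      let d' ← {d' | d' ∈ activePtr s w' ∧ (¬ target ≡ₜ .bot → docOrigin (s.get d') ≡ₜ target)}
      let input := .seq [K.POSTMESSAGE, s.get (w ++ [1]), origin, message]
      return some ([], s.set (d' ++ [7]) (snoc (s.get (d' ++ [7])) input))
    else
      return some ([], s)
  else
    return none

/-- `RUNSCRIPT` -/
def runScript (doms : Finset Str) (w d : List ℕ) (a : A) (s : BrowserState A N) :
    Set (BResult A N) := do
  let tree ← clean s (s.get d)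
  let origin := docOrigin (s.get d)
  let stored ← lookup s.cookies (comp origin 1)
  let cookies ← cookieList stored fun c => cookieHttpOnly c ≡ₜ .bot ∧
    (cookieSecure c ≡ₜ .top → comp origin 2 ≡ₜ K.HTTPS)
  let storageKey := .seq [origin, s.get (w.take 1 ++ [1])]
  let sessionStorage ← lookup s.sessionStorage storageKey
  let localStorage ← lookup s.localStorage origin
  let secrets ← lookup s.secrets origin
  let name ← {x : Str | s.get (d ++ [5]) ≡ₜ .str x}
  let R ← scriptsOf (A := A) (N := N) doms name
  let input ← {x : Msg A N | x.lift = scriptInput tree (s.get (d ++ [1])) (s.get (d ++ [6]))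
    (s.get (d ++ [7])) cookies localStorage sessionStorage s.ids secrets}
  let outl ← R input
  if (elems outl).length = 5 ∧ ∀ c ∈ elems (comp outl 2), IsCookie c then
    let out := outl.subst fun i => (.var (i + 10) : PTerm A N)
    let merged ← seqOf (cookieMerge stored (comp out 2))
    let cookies' ← update s.cookies (comp origin 1) merged
    let localStorage' ← update s.localStorage origin (comp out 3)
    let sessionStorage' ← update s.sessionStorage storageKey (comp out 4)
    let s₁ := { s with
      cookies := cookies', localStorage := localStorage', sessionStorage := sessionStorage' }
    runCommand (comp out 5) w d a (s₁.set (d ++ [6]) (comp out 1))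
  else
    ∅

/-- `PROCESSRESPONSE` -/
def processResponse (response reference request requestUrl : PTerm A N) (a : A)
    (s : BrowserState A N) : Set (BResult A N) := do
  let setCookie ← lookup response.pheaders K.SetCookie
  let stored ← lookup s.cookies request.qhost
  let newCookies ← ({l | List.Perm l ((elems setCookie).filter fun c => IsCookie c)} :
    Set (List (PTerm A N)))
  let cookies ← if HasKey response.pheaders K.SetCookie then
      update s.cookies request.qhost (newCookies.foldl addCookie stored)
    else ({s.cookies} : Set (PTerm A N))
  let sts := if HasKey response.pheaders K.STS ∧ requestUrl.protocol ≡ₜ K.HTTPS then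
    snoc s.sts request.qhost else s.sts
  let s := { s with cookies := cookies, sts := sts }
  let refererHeader ← lookup request.qheaders K.Referer
  let referrer := if HasKey request.qheaders K.Referer then refererHeader else .bot
  let location ← lookup response.pheaders K.Location
  let policy ← lookup response.pheaders K.ReferrerPolicy
  let originHeader ← lookup request.qheaders K.Origin
  if HasKey response.pheaders K.Location ∧
      (response.pstatus ≡ₜ K.s303 ∨ response.pstatus ≡ₜ K.s307) ∧
      ∃ w, Subwindows s w ∧ s.get (w ++ [1]) ≡ₜ reference then
    let u := if location.fragment ≡ₜ .bot then setAt location [6] requestUrl.fragment else location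
    let origin := if HasKey request.qheaders K.Origin then
      .seq [originHeader, .seq [request.qhost, u.protocol]] else .bot
    let toGet := response.pstatus ≡ₜ K.s303 ∧
      ¬ (request.qmethod ≡ₜ K.GET ∨ request.qmethod ≡ₜ K.HEAD)
    let method := if toGet then (K.GET : PTerm A N) else request.qmethod
    let body := if toGet then nil else request.qbody
    let req := httpReq (.var 6) method u.host u.path u.parameters nil body
    httpSend reference req u origin referrer policy a s
  else if ∃ w, Subwindows s w ∧ s.get (w ++ [1]) ≡ₜ reference then
    if ¬ IsPair response.pbody then return some ([], s)
    else
    let w ← {w | Subwindows s w ∧ s.get (w ++ [1]) ≡ₜ reference}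
    let doc := .seq [.var 7, requestUrl, response.pheaders, refererHeader, comp response.pbody 1,
      comp response.pbody 2, nil, nil, .top]
    if s.get (w ++ [2]) ≡ₜ nil then
      return some ([], s.set (w ++ [2]) (.seq [doc]))
    else
    let i ← {i | w ++ [2, i] ∈ activePtr s w}
    let s₁ := s.set (w ++ [2, i, 9]) .bot
    let docs := (elems (s₁.get (w ++ [2]))).take i
    return some ([], s₁.set (w ++ [2]) (.seq (docs ++ [doc])))
  else if ∃ w d, Subwindows s w ∧ d ∈ activePtr s w ∧ s.get (d ++ [1]) ≡ₜ comp reference 1 then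
    let d ← {d | ∃ w, Subwindows s w ∧ d ∈ activePtr s w ∧ s.get (d ++ [1]) ≡ₜ comp reference 1}
    let headers ← removeKey response.pheaders K.SetCookie
    let input := .seq [K.XMLHTTPREQUEST, headers, response.pbody, comp reference 2]
    return some ([], s.set (d ++ [7]) (snoc (s.get (d ++ [7])) input))
  else
    return some ([], s)

/-- The part of the main algorithm of a browser that handles a trigger message. -/
def browserTrigger (doms : Finset Str) (a : A) (s : BrowserState A N) : Set (BResult A N) :=
  let someWindow : Set (List ℕ) := {w | Subwindows s w ∧ ¬ s.get (w ++ [2]) ≡ₜ nil}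
  let script : Set (BResult A N) := do
    let w ← someWindow
    let d ← activePtr s w
    runScript doms w d a s
  let urlbar : Set (BResult A N) := do
    let target ← ({x | x = (.var 1, { s with windows := snoc s.windows (.seq [.var 1, nil, .bot]) })
      ∨ ∃ i, [i] ∈ someWindow ∧ x = (s.get [i, 1], s)} : Set (PTerm A N × BrowserState A N))
    let protocol ← ({K.HTTP, K.HTTPS} : Set Str)
    let host ← {x | x ∈ doms}
    let path ← (Set.univ : Set Str)
    let fragment ← (Set.univ : Set Str)
    let parameters ← stringDicts
    let u := url (.str protocol) (.str host) (.str path) parameters (.str fragment)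
    let req := httpReq (.var 2) K.GET (.str host) (.str path) parameters nil nil
    httpSend target.1 req u .bot .bot .bot a target.2
  let reload : Set (BResult A N) := do
    let w ← someWindow
    let d ← activePtr s w
    let u := s.get (d ++ [2])
    let req := httpReq (.var 2) K.GET u.host u.path u.parameters nil nil
    let n := s.get (w ++ [1])
    httpSend n req u .bot (s.get (d ++ [4])) .bot a (cancelNav n s)
  let forward : Set (BResult A N) := do
    let w ← someWindow
    let s' ← navForward w s
    return some ([], s')
  let back : Set (BResult A N) := do
    let w ← someWindow
    let s' ← navBack w s
    return some ([], s')
  {none} ∪ script ∪ urlbar ∪ reload ∪ forward ∪ back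

/-- The main algorithm of a browser. -/
def browserMain (doms : Finset Str) (a _f : A) (m : PTerm A N) (s : BrowserState A N) :
    Set (BResult A N) := do
  if ¬ s.isCorrupted ≡ₜ .bot then
    let s' := { s with pendingRequests := .seq [m, s.pendingRequests] }
    let m' ← derivable {s'.toTerm}
    let a' ← (Set.univ : Set A)
    return some ([⟨a', a, m'⟩], s')
  else if m ≡ₜ K.TRIGGER then
    browserTrigger doms a s
  else if m ≡ₜ K.FULLCORRUPT then
    return some ([], { s with isCorrupted := K.FULLCORRUPT })
  else if m ≡ₜ K.CLOSECORRUPT then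
    let cookies := .seq ((elems s.cookies).map fun x =>
      .seq [comp x 1, .seq ((elems (comp x 2)).filter fun c => cookieSession c ≡ₜ .bot)])
    return some ([], { s with
      secrets := nil, windows := nil, pendingDNS := nil, pendingRequests := nil,
      sessionStorage := nil, cookies := cookies, isCorrupted := K.CLOSECORRUPT })
  else if ∃ reference request u key f', .seq [reference, request, u, key, f'] ∈
      elems s.pendingRequests ∧ comp (.decs m key) 1 ≡ₜ K.HTTPResp then
    let ⟨reference, request, u, key, f'⟩ ← ({x | .seq [x.1, x.2.1, x.2.2.1, x.2.2.2.1, x.2.2.2.2] ∈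
      elems s.pendingRequests ∧ comp (.decs m x.2.2.2.1) 1 ≡ₜ K.HTTPResp} :
      Set (PTerm A N × PTerm A N × PTerm A N × PTerm A N × PTerm A N))
    let m' := (Term.decs m key).nf
    if ¬ m'.pnonce ≡ₜ request.qnonce then return none
    else
    let pendingRequests ← removeElem s.pendingRequests (.seq [reference, request, u, key, f'])
    processResponse m' reference request u a { s with pendingRequests := pendingRequests }
  else if comp m 1 ≡ₜ K.HTTPResp ∧ ∃ reference request u f', .seq [reference, request, u, .bot, f'] ∈
      elems s.pendingRequests ∧ m.pnonce ≡ₜ request.qnonce then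
    let ⟨reference, request, u, f'⟩ ← ({x | .seq [x.1, x.2.1, x.2.2.1, .bot, x.2.2.2] ∈
      elems s.pendingRequests ∧ m.pnonce ≡ₜ x.2.1.qnonce} :
      Set (PTerm A N × PTerm A N × PTerm A N × PTerm A N))
    let pendingRequests ← removeElem s.pendingRequests (.seq [reference, request, u, .bot, f'])
    processResponse m reference request u a { s with pendingRequests := pendingRequests }
  else if IsDNSResponse doms m then
    if ¬ HasKey s.pendingDNS m.dnonce then return none
    else
    let entry ← lookup s.pendingDNS m.dnonce
    let reference := comp entry 1
    let message := comp entry 2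
    let u := comp entry 3
    if ¬ IsAddr m.dresult ∨ ¬ m.ddomain ≡ₜ message.qhost then return none
    else
    let pendingDNS ← removeKey s.pendingDNS m.dnonce
    let key ← lookup s.keyMapping message.qhost
    if u.protocol ≡ₜ K.HTTPS then
      stopWith m.dresult (.addr a) (.enc (.seq [message, .var 3]) key)
        { s with
          pendingDNS := pendingDNS
          pendingRequests :=
            snoc s.pendingRequests (.seq [reference, message, u, .var 3, m.dresult]) }
    else
      stopWith m.dresult (.addr a) message
        { s with
          pendingDNS := pendingDNS
          pendingRequests :=
            snoc s.pendingRequests (.seq [reference, message, u, .bot, m.dresult]) }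
  else
    return none

/-- The process of a web browser with the given addresses and initial state. -/
def browserProcess (doms : Finset Str) (addrs : Set A) (init : Msg A N) : AtomicProcess A N :=
  ⟨addrs, algRel BrowserState.toTerm (browserMain doms), init⟩

end Browser

end
/-! # OIDC web systems -/

/-- The processes of an OIDC web system. -/
inductive Party (B R I W D : Type) : Type
  | browser (b : B)
  | rp (r : R)
  | idp (i : I)
  | attacker (w : W)
  | dns (d : D)

namespace Party

variable {B R I W D : Type}

/-- The parties other than attackers. -/
def Hon : Party B R I W D → Prop
  | attacker _ => False
  | _ => True

/-- The relying parties and the identity providers. -/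
def IsServer : Party B R I W D → Prop
  | rp _ => True
  | idp _ => True
  | _ => False

end Party

/-- The data of an OIDC web system with browsers `B`, relying parties `R`, identity providers `I`,
attackers `W` and DNS servers `D`, over the addresses `A` and the nonces `N`. -/
structure Setup (A N B R I W D : Type) where
  addr : Party B R I W D → Finset A
  dom : Party B R I W D → Finset Str
  /-- The set of all domains. -/
  Doms : Finset Str
  /-- The sequence of the nonces that are available for the processes. -/
  fresh : Stream' N
  KTLS : Finset N
  Ksign : Finset N
  Passwords : Finset N
  tlskey : Str → N
  signkey : I → N
  /-- The identities, as pairs of a name and a domain. -/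
  IDs : Finset (Str × Str)
  secretOfID : Str × Str → N
  ownerOfSecret : {n // n ∈ Passwords} → B
  /-- The addresses that an attacker listens to and uses as sender addresses. -/
  attAddrs : W → Set A
  dnsTable : D → List (Str × A)
  /-- The mapping of the domains to their public keys, for browsers, relying parties and identity
  providers. -/
  keyMapping : Msg A N
  /-- The address that a party uses for DNS requests. -/
  dnsAddress : Party B R I W D → A
  /-- The initial states. -/
  init : Party B R I W D → Msg A N

namespace Setup

variable {A N B R I W D : Type} (X : Setup A N B R I W D)

/-- `ID^p`: the identities governed by `p`. -/
def idsOf (p : Party B R I W D) : Set (Str × Str) := {id | id ∈ X.IDs ∧ id.2 ∈ X.dom p}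

/-- `ID_b`: the identities that belong to the browser `b`. -/
def idsOfBrowser (b : B) : Set (Str × Str) :=
  {id | id ∈ X.IDs ∧ ∃ h : X.secretOfID id ∈ X.Passwords, X.ownerOfSecret ⟨_, h⟩ = b}

/-- `Secrets^{b,p}` -/
def secrets (b : B) (p : Party B R I W D) : Set N :=
  {n | (∃ h : n ∈ X.Passwords, X.ownerOfSecret ⟨n, h⟩ = b) ∧ ∃ id ∈ X.idsOf p, X.secretOfID id = n}

/-- `password` is the password of `identity`. -/
def IsPassword (identity password : PTerm A N) : Prop :=
  ∃ id ∈ X.IDs, identity ≡ₜ idTerm id ∧ password ≡ₜ .nonce (X.secretOfID id)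

/-- The pairs of the domains in a set and their private keys. -/
def privKeys (ds : Finset Str) : Set (Msg A N) :=
  {t | ∃ d ∈ ds, t = .seq [.str d, .nonce (X.tlskey d)]}

/-- The pairs of all domains and their public keys. -/
def pubKeys : Set (Msg A N) :=
  {t | ∃ d ∈ X.Doms, t = .seq [.str d, .pub (.nonce (X.tlskey d))]}

/-- `t` is a tuple whose components are equivalent to those in the list. -/
def IsTuple (t : Msg A N) (l : List (Msg A N)) : Prop :=
  ∃ l', t = .seq l' ∧ List.Forall₂ Term.Eqv l' l

/-- The initial states of the parties; the order of the elements of a set that is written as a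
sequence is arbitrary. -/
def IsInitial : Party B R I W D → Msg A N → Prop
  | .browser b, t => ∃ ids ∈ seqOf (idTerm '' X.idsOfBrowser b),
      ∃ sec : Party B R I W D → Msg A N, (∀ p, sec p ∈ seqOf (Term.nonce '' X.secrets b p)) ∧
      ∃ secrets ∈ seqOf {x | ∃ p, p.IsServer ∧ ∃ d ∈ X.dom p,
        x = .seq [.seq [.str d, .str K.HTTPS], sec p]},
      IsTuple t [nil, ids, secrets, nil, nil, nil, X.keyMapping, nil,
        .addr (X.dnsAddress (.browser b)), nil, nil, .bot]
  | .rp r, t => ∃ tlskeys ∈ seqOf (X.privKeys (X.dom (.rp r))),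
      IsTuple t [.addr (X.dnsAddress (.rp r)), nil, nil, .bot, X.keyMapping, tlskeys,
        nil, nil, nil, nil, nil]
  | .idp i, t => ∃ tlskeys ∈ seqOf (X.privKeys (X.dom (.idp i))),
      IsTuple t [.addr (X.dnsAddress (.idp i)), nil, nil, .bot, X.keyMapping, tlskeys,
        nil, nil, nil, .nonce (X.signkey i)]
  | .attacker w, t => ∃ attdoms ∈ seqOf (X.privKeys (X.dom (.attacker w))),
      ∃ tlskeys ∈ seqOf X.pubKeys,
      ∃ signkeys ∈ seqOf {x | ∃ i, x = .pub (.nonce (X.signkey i))},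
      IsTuple t [attdoms, tlskeys, signkeys]
  | .dns d, t => IsTuple t ((X.dnsTable d).map fun x => .seq [.str x.1, .addr x.2])

/-- The conditions that are common to both kinds of OIDC web systems. -/
structure IsSystem : Prop where
  addr_disjoint : ∀ p q, p.Hon → q.Hon → p ≠ q → Disjoint (X.addr p) (X.addr q)
  dom_browser : ∀ b, X.dom (.browser b) = ∅
  dom_dns : ∀ d, X.dom (.dns d) = ∅
  dom_disjoint : ∀ p q, p ≠ q → Disjoint (X.dom p) (X.dom q)
  mem_Doms : ∀ d, d ∈ X.Doms ↔ ∃ p, d ∈ X.dom p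
  fresh_injective : Function.Injective X.fresh.get
  nonces_cover : ∀ n, n ∈ Set.range X.fresh.get ∨ n ∈ X.KTLS ∨ n ∈ X.Ksign ∨ n ∈ X.Passwords
  nonces_disjoint : [Set.range X.fresh.get, (X.KTLS : Set N), X.Ksign, X.Passwords].Pairwise Disjoint
  tlskey_mapsTo : ∀ d ∈ X.Doms, X.tlskey d ∈ X.KTLS
  tlskey_injOn : Set.InjOn X.tlskey X.Doms
  signkey_mem : ∀ i, X.signkey i ∈ X.Ksign
  signkey_injective : Function.Injective X.signkey
  ids_dom : ∀ id ∈ X.IDs, id.2 ∈ X.Doms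
  secretOfID_bijOn : Set.BijOn X.secretOfID X.IDs X.Passwords
  keyMapping_mem : X.keyMapping ∈ seqOf X.pubKeys
  init : ∀ p, X.IsInitial p (X.init p)

/-- OIDC web systems with a network attacker. -/
structure IsNetworkSystem : Prop extends X.IsSystem where
  one_attacker : Nat.card W = 1
  no_dns : IsEmpty D
  attAddrs_eq : ∀ w, X.attAddrs w = Set.univ

/-- OIDC web systems with web attackers. -/
structure IsWebSystem : Prop extends X.IsSystem where
  finite_attackers : Finite W
  one_dns : Nat.card D = 1
  attAddrs_eq : ∀ w, X.attAddrs w = X.addr (.attacker w)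
  attacker_disjoint : ∀ w p, p ≠ .attacker w → Disjoint (X.addr (.attacker w)) (X.addr p)
  dnsAddress_mem : ∀ p d, X.dnsAddress p ∈ X.addr (.dns d)
  dnsTable_keys : ∀ d, ((X.dnsTable d).map Prod.fst).Nodup
  dnsTable_mem : ∀ d, ∀ x ∈ X.dnsTable d, ∃ p, x.1 ∈ X.dom p ∧ x.2 ∈ X.addr p

/-- The processes of the system. -/
noncomputable def process : Party B R I W D → AtomicProcess A N
  | .browser b => browserProcess X.Doms (X.addr (.browser b)) (X.init (.browser b))
  | .rp r => serverProcess X.Doms (rpServer (X.dom (.rp r))) (X.addr (.rp r)) (X.init (.rp r))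
  | .idp i => serverProcess X.Doms
      (idpServer (X.dom (.idp i)) (X.idsOf (.idp i)) X.IsPassword) (X.addr (.idp i))
      (X.init (.idp i))
  | .attacker w => ⟨X.attAddrs w, attackerRel (X.attAddrs w), X.init (.attacker w)⟩
  | .dns d => ⟨X.addr (.dns d), dnsRel X.Doms (X.dnsTable d), X.init (.dns d)⟩

/-- The event `⟨a, a, TRIGGER⟩`. -/
def trigger (a : A) : Event A (Msg A N) := ⟨a, a, .str K.TRIGGER⟩

/-- `E⁰` consists of trigger events, infinitely many for each address of a process. -/
def IsInitialEvents (E : Stream' (Event A (Msg A N))) : Prop :=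
  (∀ n, ∃ p, ∃ a ∈ (X.process p).addrs, E.get n = trigger a) ∧
  ∀ p, ∀ a ∈ (X.process p).addrs, {n | E.get n = trigger a}.Infinite

variable {X} {E₀ : Stream' (Event A (Msg A N))}

/-- The server `p` is honest in the configuration `c`. -/
def Honest (p : Party B R I W D) (c : Config (Party B R I W D) A N) : Prop :=
  comp (c.S p) 4 ≡ₜ .bot

/-- In the run `ρ`, the relying party `r` sends, in the `n`-th processing step, the HTTPS request
`m` with the symmetric key `k`. -/
def SendsRequest (ρ : Run X.process E₀ X.fresh) (n : ℕ) (r : R) (m k : Msg A N) : Prop :=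
  (n : ℕ∞) < ρ.len ∧
  ∃ e E s Eout, StepWith X.process (ρ.conf n) e (.rp r) E s Eout (ρ.conf (n + 1)) ∧
    ∃ ev ∈ Eout, ∃ K, ev.msg ≡ₜ .enc (.seq [m, k]) K

/-- In the run `ρ`, the identity provider `i` sends, in the `n`-th processing step, the HTTPS
response `m'`, encrypted with `k`, to the registration request `m`. -/
def SendsRegResponse (ρ : Run X.process E₀ X.fresh) (n : ℕ) (i : I) (m k m' : Msg A N) : Prop :=
  (n : ℕ∞) < ρ.len ∧
  ∃ e E s Eout, StepWith X.process (ρ.conf n) e (.idp i) E s Eout (ρ.conf (n + 1)) ∧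
    (∃ a f σ σ', ((ρ.conf n).S (.idp i)).lift = (idpServer (X.dom (.idp i)) (X.idsOf (.idp i))
        X.IsPassword).toTerm σ ∧
      s = (idpServer (X.dom (.idp i)) (X.idsOf (.idp i)) X.IsPassword).toTerm σ' ∧
      .seq [m.lift, k.lift, a, f] ∈ elems σ.app.registrationRequests ∧
      some (E, σ') ∈ idpRegister e.msg.lift m.lift k.lift a f σ) ∧
    ∃ ev ∈ Eout, ev.msg ≡ₜ .encs m' k

/-- In the run `ρ`, the client id `c` has been issued to `r` by `i`: a registration request that was
sent by `r` has been answered by `i` with a response that contains `c` as the client id. -/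
def Issued (ρ : Run X.process E₀ X.fresh) (c : Msg A N) (r : R) (i : I) : Prop :=
  ∃ n₁ n₂ m k m', n₁ < n₂ ∧ SendsRequest ρ n₁ r m k ∧ SendsRegResponse ρ n₂ i m k m' ∧
    HasKey m'.pbody K.client_id ∧ ∃ c' ∈ lookup m'.pbody K.client_id, c ≡ₜ c'

end Setup

end OIDC

-- The argument is a pair of invariants. No cryptographic reasoning is needed: `Setup.Issued`
-- already ties the response of the identity provider to the request `m` that the relying party
-- sent, and the stored record is computed from that same `m`.
--
-- Relying party. Call a request body good (`GoodBody`) if it is a dictionary with string keys in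
-- which every value under `redirect_uris` is a sequence of HTTPS URLs with hosts in the domains of
-- the party. Every body that an honest relying party writes is good: the registration request lists
-- exactly the URLs built from its own domains, and all other requests have no key `redirect_uris`
-- at all, so they are harmless even if they are taken for registration requests. A request is not
-- sent at once but waits in `pendingDNS` until the DNS response arrives. The invariant is therefore
-- that `pendingDNS` holds only requests with good bodies (`GoodDNS`), and it implies that every
-- request sent is good. `rp_step` gives the inductive step and `goodDNS_of_honest` the induction.
-- Corruption is irreversible (`honest_mono`), so honesty at the configuration under consideration
-- gives the invariant at all earlier ones.
--
-- Identity provider. A client id is accepted only if it is not yet a key of `clients`, and no step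
-- changes or removes a stored record (`idp_step`). Hence keys persist (`hasKey_clients_mono`), and
-- a record found later under a key is the one found at any earlier time at which the key was
-- present (`clients_entry_of_le`). At the moment of issue the record copies the value of
-- `redirect_uris` from `m` (`idp_register`), so it is good when the body of `m` is. These facts
-- together give the theorem.
--
-- The technical layer transports this between terms with placeholders, on which the algorithms
-- work, and messages, of which states consist. All invariants are therefore formulated so that they
-- are stable under the equational theory and under substitution.

namespace OIDC

-- Substitution and the equational theory

namespace Term

variable {A N N' V W : Type}

theorem Eqv.refl (t : Term A N V) : t ≡ₜ t := rfl

theorem Eqv.symm {t u : Term A N V} (h : t ≡ₜ u) : u ≡ₜ t := Eq.symm h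

theorem Eqv.trans {t u v : Term A N V} (h : t ≡ₜ u) (h' : u ≡ₜ v) : t ≡ₜ v := Eq.trans h h'

theorem nf_eqv (t : Term A N V) : t.nf ≡ₜ t := ((eqv_iff_cong _ _).2 (cong_nf t)).symm

@[simp] theorem nf_nf (t : Term A N V) : t.nf.nf = t.nf := nf_eqv t

@[simp] theorem nf_seq (l : List (Term A N V)) : (Term.seq l).nf = .seq (l.map nf) := by
  rw [nf, nfList_eq_map]

theorem seq_pair_eqv {a b c d : Term A N V} :
    Term.seq [a, b] ≡ₜ .seq [c, d] ↔ a ≡ₜ c ∧ b ≡ₜ d := by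
  simp [Eqv, nf, nfList]

theorem eqv_of_encs_eqv {t u t' u' : Term A N V} (h : Term.encs t u ≡ₜ .encs t' u') : t ≡ₜ t' := by
  simp only [Eqv, nf, Term.encs.injEq] at h
  exact h.1

theorem bindList_eq_map (fn : N → Term A N' W) (fv : V → Term A N' W) (l : List (Term A N V)) :
    bindList fn fv l = l.map (bind fn fv) := by
  induction l with
  | nil => rfl
  | cons t l ih => simp [bindList, ih]

@[simp] theorem subst_seq (f : V → Term A N W) (l : List (Term A N V)) :
    (Term.seq l).subst f = .seq (l.map (subst f)) := by
  simp only [subst, bind, bindList_eq_map]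
  rfl

@[simp] theorem subst_str (f : V → Term A N W) (s : Str) : (Term.str s).subst f = .str s := rfl

@[simp] theorem subst_enc (f : V → Term A N W) (t u : Term A N V) :
    (Term.enc t u).subst f = .enc (t.subst f) (u.subst f) := rfl

@[simp] theorem subst_encs (f : V → Term A N W) (t u : Term A N V) :
    (Term.encs t u).subst f = .encs (t.subst f) (u.subst f) := rfl

/-- Each equation of the theory is a schema, so a substitution instance of it is again an equation.
The congruence is used instead of normal forms because `nf` does not commute with substitution:
replacing variables can create new redexes. -/
theorem Cong.subst (f : V → Term A N W) {t u : Term A N V} (h : Cong t u) :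
    Cong (t.subst f) (u.subst f) := by
  induction h with
  | refl t => exact .refl _
  | symm _ ih => exact ih.symm
  | trans _ _ ih ih' => exact ih.trans ih'
  | pub _ ih => exact .pub ih
  | enc _ _ ih ih' => exact .enc ih ih'
  | dec _ _ ih ih' => exact .dec ih ih'
  | encs _ _ ih ih' => exact .encs ih ih'
  | decs _ _ ih ih' => exact .decs ih ih'
  | sig _ _ ih ih' => exact .sig ih ih'
  | checksig _ _ ih ih' => exact .checksig ih ih'
  | extractmsg _ ih => exact .extractmsg ih
  | seq l₁ l₂ _ ih => simpa using Cong.seq _ _ ih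
  | proj i _ ih => exact .proj i ih
  | dec_enc x y => exact .dec_enc _ _
  | decs_encs x y => exact .decs_encs _ _
  | checksig_sig x y => exact .checksig_sig _ _
  | extractmsg_sig x y => exact .extractmsg_sig _ _
  | proj_seq l i x h =>
    have := Cong.proj_seq (l.map (Term.subst f)) i (x.subst f) (by simp [h])
    rwa [← subst_seq] at this
  | proj_undef l i h =>
    have := Cong.proj_undef (l.map (Term.subst f)) i (by simpa using h)
    rwa [← subst_seq] at this

theorem Eqv.subst (f : V → Term A N W) {t u : Term A N V} (h : t ≡ₜ u) :
    t.subst f ≡ₜ u.subst f :=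
  (eqv_iff_cong _ _).2 (((eqv_iff_cong _ _).1 h).subst f)

theorem Eqv.proj (i : ℕ) {t u : Term A N V} (h : t ≡ₜ u) : Term.proj i t ≡ₜ Term.proj i u := by
  unfold Eqv at *
  rw [nf, nf, h]

theorem subst_lift (f : V → Term A N W) : ∀ t : Msg A N, (lift t : Term A N V).subst f = lift t
  | .nonce _ => rfl
  | .addr _ => rfl
  | .str _ => rfl
  | .top => rfl
  | .bot => rfl
  | .undef => rfl
  | .pub t => congrArg Term.pub (subst_lift f t)
  | .enc t u => congrArg₂ Term.enc (subst_lift f t) (subst_lift f u)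
  | .dec t u => congrArg₂ Term.dec (subst_lift f t) (subst_lift f u)
  | .encs t u => congrArg₂ Term.encs (subst_lift f t) (subst_lift f u)
  | .decs t u => congrArg₂ Term.decs (subst_lift f t) (subst_lift f u)
  | .sig t u => congrArg₂ Term.sig (subst_lift f t) (subst_lift f u)
  | .checksig t u => congrArg₂ Term.checksig (subst_lift f t) (subst_lift f u)
  | .extractmsg t => congrArg Term.extractmsg (subst_lift f t)
  | .proj i t => congrArg (Term.proj i) (subst_lift f t)
  | .seq l => by
    have h : ∀ t ∈ l, (lift t : Term A N V).subst f = lift t := fun t _ => subst_lift f t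
    simp only [lift, subst_seq, List.map_map] at h ⊢
    exact congrArg Term.seq (List.map_congr_left h)

theorem lift_self : ∀ t : Msg A N, (lift t : Msg A N) = t
  | .nonce _ => rfl
  | .addr _ => rfl
  | .str _ => rfl
  | .top => rfl
  | .bot => rfl
  | .undef => rfl
  | .pub t => congrArg Term.pub (lift_self t)
  | .enc t u => congrArg₂ Term.enc (lift_self t) (lift_self u)
  | .dec t u => congrArg₂ Term.dec (lift_self t) (lift_self u)
  | .encs t u => congrArg₂ Term.encs (lift_self t) (lift_self u)
  | .decs t u => congrArg₂ Term.decs (lift_self t) (lift_self u)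
  | .sig t u => congrArg₂ Term.sig (lift_self t) (lift_self u)
  | .checksig t u => congrArg₂ Term.checksig (lift_self t) (lift_self u)
  | .extractmsg t => congrArg Term.extractmsg (lift_self t)
  | .proj i t => congrArg (Term.proj i) (lift_self t)
  | .seq l => by
    have h : ∀ t ∈ l, (lift t : Msg A N) = t := fun t _ => lift_self t
    simp only [lift, subst_seq] at h ⊢
    exact congrArg Term.seq ((List.map_congr_left h).trans (List.map_id' l))

@[simp] theorem subst_lift_msg (f : V → Msg A N) (t : Msg A N) :
    (lift t : Term A N V).subst f = t := (subst_lift f t).trans (lift_self t)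

-- The old state and the incoming message enter an algorithm as lifted terms. Having no
-- placeholders, they come back unchanged whatever nonces are drawn.
@[simp] theorem instantiate_lift (vs : Finset ℕ) (ν : Stream' N) (t : Msg A N) :
    instantiate vs ν t.lift = t := subst_lift_msg _ t

end Term

open Term

-- Sequences and dictionaries under substitution; the invariants on request bodies

section Data

variable {A N V W : Type}

theorem elems_congr {t u : Term A N V} (h : t ≡ₜ u) : elems t = elems u := by
  unfold elems
  rw [show t.nf = u.nf from h]

@[simp] theorem elems_seq (l : List (Term A N V)) : elems (.seq l) = l.map nf := by
  simp [elems]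

/-- A term whose normal form is not a sequence has no elements, so one element suffices to know that
the term is a sequence. -/
theorem eqv_seq_of_mem_elems {t x : Term A N V} (h : x ∈ elems t) : t ≡ₜ .seq (elems t) := by
  have h₁ : t.nf = .seq (elems t) := by
    unfold elems at h ⊢
    split at h
    · assumption
    · simp at h
  exact (nf_eqv t).symm.trans (h₁ ▸ Eqv.refl _)

theorem nf_of_mem_elems {t x : Term A N V} (h : x ∈ elems t) : x.nf = x := by
  have h₁ := elems_congr (eqv_seq_of_mem_elems h)
  rw [elems_seq] at h₁
  rw [h₁] at h
  obtain ⟨y, _, rfl⟩ := List.mem_map.1 h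
  simp

/-- Only this inclusion holds in general: a term that is not a sequence, such as a blocked
decryption, can become one after substitution. -/
theorem mem_elems_subst (f : V → Term A N W) {t x : Term A N V} (h : x ∈ elems t) :
    (x.subst f).nf ∈ elems (t.subst f) := by
  rw [elems_congr ((eqv_seq_of_mem_elems h).subst f), subst_seq, elems_seq]
  exact List.mem_map_of_mem (List.mem_map_of_mem h)

/-- Presence of a key survives substitution; absence need not, because different keys can be
identified. Absence is therefore always transported by contraposition, from a lifted term back to
the message. -/
theorem HasKey.subst (f : V → Term A N W) {t k : Term A N V} (h : HasKey t k) :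
    HasKey (t.subst f) (k.subst f) := by
  obtain ⟨v, hv⟩ := h
  refine ⟨(v.subst f).nf, ?_⟩
  have := mem_elems_subst f hv
  rwa [subst_seq, nf_seq, List.map_map, List.map_cons, List.map_cons, List.map_nil,
    Function.comp, show (k.nf.subst f).nf = (k.subst f).nf from (nf_eqv k).subst f] at this

theorem HasKey.congr {t t' k k' : Term A N V} (ht : t ≡ₜ t') (hk : k ≡ₜ k') (h : HasKey t k) :
    HasKey t' k' := by
  unfold HasKey at *
  rwa [← elems_congr ht, ← show k.nf = k'.nf from hk]

theorem comp_eqv (t : Term A N V) (i : ℕ) : comp t i ≡ₜ .proj i t := nf_eqv _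

theorem comp_congr {t u : Term A N V} (h : t ≡ₜ u) (i : ℕ) : comp t i = comp u i := h.proj i

theorem proj_seq_eqv {l : List (Term A N V)} {i : ℕ} {x : Term A N V} (h : l[i]? = some x) :
    .proj (i + 1) (.seq l) ≡ₜ x := nf_eq_of_cong (.proj_seq l i x h)

theorem comp_seq {l : List (Term A N V)} {i : ℕ} {x : Term A N V} (h : l[i]? = some x) :
    comp (.seq l) (i + 1) = x.nf := proj_seq_eqv h

/-- The term is a sequence, and its elements have the property `P`. -/
def AllElems (P : Term A N V → Prop) (t : Term A N V) : Prop :=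
  ∃ l, t ≡ₜ .seq l ∧ ∀ x ∈ l, P x

namespace AllElems

variable {P : Term A N V → Prop}

theorem congr {t u : Term A N V} (h : t ≡ₜ u) (ht : AllElems P t) : AllElems P u :=
  let ⟨l, hl, hP⟩ := ht
  ⟨l, h.symm.trans hl, hP⟩

/-- This is why `AllElems` demands that the term be a sequence: a condition on `elems` alone would
hold vacuously for a variable and be lost when a sequence is substituted for it. The list need not
consist of normal forms, so no invariance of the property under `≡ₜ` is required. -/
theorem subst (f : V → Term A N W) {Q : Term A N W → Prop} (hPQ : ∀ x, P x → Q (x.subst f))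
    {t : Term A N V} (ht : AllElems P t) : AllElems Q (t.subst f) := by
  obtain ⟨l, hl, hP⟩ := ht
  refine ⟨l.map (Term.subst f), by simpa using hl.subst f, ?_⟩
  intro x hx
  obtain ⟨y, hy, rfl⟩ := List.mem_map.1 hx
  exact hPQ y (hP y hy)

theorem nil : AllElems P (.seq []) := ⟨[], rfl, by simp⟩

theorem of_mem (hP : ∀ x y, x ≡ₜ y → P x → P y) {t x : Term A N V} (ht : AllElems P t)
    (hx : x ∈ elems t) : P x := by
  obtain ⟨l, hl, h⟩ := ht
  rw [elems_congr hl, elems_seq] at hx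
  obtain ⟨y, hy, rfl⟩ := List.mem_map.1 hx
  exact hP _ _ (nf_eqv y).symm (h y hy)

theorem update (hP : ∀ x y, x ≡ₜ y → P x → P y) {z k v z' : Term A N V} (hz : AllElems P z)
    (hv : P (.seq [k, v])) (h : z' ∈ update z k v) : AllElems P z' := by
  rcases h with ⟨l₁, v₀, l₂, h, rfl⟩ | ⟨-, rfl⟩
  · refine ⟨_, rfl, fun x hx => ?_⟩
    simp only [List.mem_append, List.mem_cons] at hx
    rcases hx with hx | rfl | hx
    · exact hz.of_mem hP (by simp [h, hx])
    · exact hv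
    · exact hz.of_mem hP (by simp [h, hx])
  · refine ⟨_, rfl, fun x hx => ?_⟩
    simp only [List.mem_append, List.mem_singleton] at hx
    rcases hx with hx | rfl
    · exact hz.of_mem hP hx
    · exact hv

theorem removeKey (hP : ∀ x y, x ≡ₜ y → P x → P y) {z k z' : Term A N V} (hz : AllElems P z)
    (h : z' ∈ removeKey z k) : AllElems P z' := by
  rcases h with ⟨l₁, v₀, l₂, h, rfl⟩ | ⟨-, rfl⟩
  · refine ⟨_, rfl, fun x hx => hz.of_mem hP ?_⟩
    simp only [List.mem_append] at hx
    rcases hx with hx | hx <;> simp [h, hx]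
  · exact hz

end AllElems

/-- The URL has the protocol HTTPS and a host in `ds`. -/
def GoodURI (ds : Finset Str) (u : Term A N V) : Prop :=
  (∃ d ∈ ds, u.host ≡ₜ .str d) ∧ u.protocol ≡ₜ .str K.HTTPS

theorem GoodURI.congr {ds : Finset Str} (u v : Term A N V) (h : u ≡ₜ v) (hu : GoodURI ds u) :
    GoodURI ds v := by
  unfold GoodURI Term.host Term.protocol at *
  rwa [← comp_congr h, ← comp_congr h]

theorem GoodURI.subst {ds : Finset Str} (f : V → Term A N W) (u : Term A N V)
    (hu : GoodURI ds u) : GoodURI ds (u.subst f) := by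
  obtain ⟨⟨d, hd, h⟩, h'⟩ := hu
  exact ⟨⟨d, hd, (comp_eqv _ _).trans (((comp_eqv _ _).symm.trans h).subst f)⟩,
    (comp_eqv _ _).trans (((comp_eqv _ _).symm.trans h').subst f)⟩

/-- The entry of a dictionary has a string as its key; if that is `redirect_uris`, then the value is
a sequence of HTTPS URLs with hosts in `ds`. -/
def GoodEntry (ds : Finset Str) (x : Term A N V) : Prop :=
  ∃ (k : Str) (v : Term A N V), x ≡ₜ .seq [.str k, v] ∧
    (k = K.redirect_uris → AllElems (GoodURI ds) v)

theorem GoodEntry.congr {ds : Finset Str} (x y : Term A N V) (h : x ≡ₜ y) (hx : GoodEntry ds x) :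
    GoodEntry ds y :=
  let ⟨k, v, h', hv⟩ := hx
  ⟨k, v, h.symm.trans h', hv⟩

/-- String keys are fixed by substitution. Without that requirement, a key containing variables
could turn into `redirect_uris` and expose an uncontrolled value. -/
theorem GoodEntry.subst {ds : Finset Str} (f : V → Term A N W) (x : Term A N V)
    (hx : GoodEntry ds x) : GoodEntry ds (x.subst f) :=
  let ⟨k, v, h, hv⟩ := hx
  ⟨k, v.subst f, by simpa using h.subst f, fun hk => (hv hk).subst f (GoodURI.subst f)⟩

theorem GoodEntry.of_ne {ds : Finset Str} {k : Str} (hk : k ≠ K.redirect_uris) (v : Term A N V) :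
    GoodEntry ds (.seq [.str k, v]) := ⟨k, v, rfl, fun h => absurd h hk⟩

/-- Dictionaries with string keys that store only HTTPS URLs with hosts in `ds` under
`redirect_uris`. -/
abbrev GoodBody (ds : Finset Str) : Term A N V → Prop := AllElems (GoodEntry ds)

theorem GoodBody.lookup {ds : Finset Str} {b v : Term A N V} (hb : GoodBody ds b)
    (hv : v ∈ lookup b (.str K.redirect_uris)) : AllElems (GoodURI ds) v := by
  rcases hv with hv | ⟨-, rfl⟩
  · obtain ⟨k, w, h, hw⟩ := hb.of_mem GoodEntry.congr hv
    obtain ⟨h₁, h₂⟩ := seq_pair_eqv.1 h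
    refine (hw ?_).congr h₂.symm
    simpa [Eqv, nf] using h₁.symm
  -- The default value of a missing key is the empty tuple, which has no elements to check.
  · exact .nil

/-- The entry of a dictionary of pending DNS requests contains a request with a good body. -/
def GoodPending (ds : Finset Str) (x : Term A N V) : Prop :=
  GoodBody ds (.proj 8 (.proj 2 (.proj 2 x)))

theorem GoodPending.congr {ds : Finset Str} (x y : Term A N V) (h : x ≡ₜ y)
    (hx : GoodPending ds x) : GoodPending ds y :=
  AllElems.congr (((h.proj 2).proj 2).proj 8) hx

/-- An entry has the shape ⟨ν, ⟨reference, request⟩⟩, and the body is the eighth component of the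
request. The path is written with `Term.proj`, which commutes with substitution by definition,
whereas `comp` normalizes. -/
theorem GoodPending.subst {ds : Finset Str} (f : V → Term A N W) (x : Term A N V)
    (hx : GoodPending ds x) : GoodPending ds (x.subst f) :=
  AllElems.subst f (GoodEntry.subst f) hx

/-- Dictionaries of pending DNS requests for requests with good bodies. -/
abbrev GoodDNS (ds : Finset Str) : Term A N V → Prop := AllElems (GoodPending ds)

end Data

-- Postconditions of nondeterministic algorithms

section Algorithms

variable {A N St : Type}

open scoped Classical
attribute [local instance] Set.monad

/-- All results in `M` have the property `Q`. -/
def Post {α : Type} (Q : α → Prop) (M : Set α) : Prop := ∀ o ∈ M, Q o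

/-- With the rules for `pure` and conditionals, this lets a proof follow the text of an algorithm.
Most choices are irrelevant to the invariants and are discarded along the way. -/
theorem Post.bind {α β : Type} {Q : β → Prop} {M : Set α} {f : α → Set β}
    (h : ∀ x ∈ M, Post Q (f x)) : Post Q (M >>= f) := by
  intro o ho
  simp only [Set.bind_def, Set.mem_iUnion] at ho
  obtain ⟨x, hx, ho⟩ := ho
  exact h x hx o ho

theorem Post.pure {α : Type} {Q : α → Prop} {x : α} (h : Q x) : Post Q (pure x) := by
  intro o ho
  rw [Set.pure_def, Set.mem_singleton_iff] at ho
  exact ho ▸ h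

theorem Post.ite {α : Type} {Q : α → Prop} {c : Prop} [Decidable c] {M M' : Set α}
    (h : c → Post Q M) (h' : ¬ c → Post Q M') : Post Q (if c then M else M') := by
  split_ifs with hc
  · exact h hc
  · exact h' hc

/-- A property of results that concerns only those that change the state or produce output. -/
def OnSome (Q : List (Event A (PTerm A N)) → St → Prop) : Result A N St → Prop
  | none => True
  | some (E, s) => Q E s

theorem Post.stopWith {Q : List (Event A (PTerm A N)) → St → Prop} {dst src msg : PTerm A N}
    {s : St} (h : ∀ a b, Q [⟨a, b, msg⟩] s) : Post (OnSome Q) (stopWith dst src msg s) := by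
  rintro o ⟨a, b, -, -, rfl⟩
  exact h a b

-- Relying parties write and send only good request bodies

/-- Outputs of an honest relying party: the requests in public-key encrypted messages have good
bodies. -/
def GoodOut (ds : Finset Str) (t : PTerm A N) : Prop :=
  (∃ l, t = .seq l) ∨ (∃ x k, t = .encs x k) ∨
    ∃ m x k, t = .enc (.seq [m, x]) k ∧ GoodBody ds m.qbody

def RPGood (ds : Finset Str) (E : List (Event A (PTerm A N))) (s : RPState A N) : Prop :=
  GoodDNS ds s.pendingDNS ∧ ∀ ev ∈ E, GoodOut ds ev.msg

theorem RPGood.encs {ds : Finset Str} {s : RPState A N} (hs : GoodDNS ds s.pendingDNS)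
    (x k : PTerm A N) (a b : A) : RPGood ds [⟨a, b, .encs x k⟩] s :=
  ⟨hs, by simp [GoodOut]⟩

/-- Only a DNS query, which is a plain sequence, leaves the party here. The request itself is parked
in `pendingDNS`, so its body has to be checked at this point. -/
theorem post_simpleSend {ds : Finset Str} {reference message : PTerm A N} {a : A}
    {s : RPState A N} (hs : GoodDNS ds s.pendingDNS) (hm : GoodBody ds message.qbody) :
    Post (OnSome (RPGood ds)) (simpleSend reference message a s) := by
  unfold simpleSend
  refine .bind fun p hp => .stopWith fun _ _ => ⟨?_, ?_⟩
  · refine hs.update GoodPending.congr ?_ hp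
    exact hm.congr ((comp_eqv _ _).trans (Eqv.proj 8 (Eqv.refl _)))
  · simp [GoodOut]

theorem GoodBody.qbody {ds : Finset Str} {n me h p pa he b : PTerm A N} (hb : GoodBody ds b) :
    GoodBody ds (httpReq n me h p pa he b).qbody := by
  unfold httpReq Term.qbody
  rw [comp_seq (i := 7) rfl]
  exact hb.congr (nf_eqv b).symm

theorem GoodBody.dict {ds : Finset Str} (l : List (Str × PTerm A N))
    (hl : ∀ p ∈ l, p.1 = K.redirect_uris → AllElems (GoodURI ds) p.2) :
    GoodBody ds (dict (l.map fun p => (.str p.1, p.2))) := by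
  refine ⟨_, rfl, ?_⟩
  simp only [List.map_map, List.mem_map, Function.comp]
  rintro _ ⟨p, hp, rfl⟩
  exact ⟨p.1, p.2, rfl, hl p hp⟩

theorem goodURI_url {ds : Finset Str} {d : Str} (hd : d ∈ ds) (p pa fr : PTerm A N) :
    GoodURI ds (url K.HTTPS (.str d) p pa fr) :=
  ⟨⟨d, hd, rfl⟩, rfl⟩

/-- The registration branch is the only one that writes `redirect_uris` into a request body, and its
URLs range over the party's own domains. The other requests have empty bodies. -/
theorem post_startLoginFlow {ds : Finset Str} {sessionId : PTerm A N} {a : A} {s : RPState A N}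
    (hs : GoodDNS ds s.pendingDNS) :
    Post (OnSome (RPGood ds)) (startLoginFlow ds sessionId a s) := by
  unfold startLoginFlow
  refine .bind fun session _ => .bind fun identity _ => .ite (fun _ => ?_) fun _ => ?_
  · exact post_simpleSend hs (GoodBody.qbody .nil)
  refine .bind fun issuer _ => .ite (fun _ => ?_) fun _ => ?_
  · exact post_simpleSend hs (GoodBody.qbody .nil)
  refine .bind fun oidcConfig _ => .ite (fun _ => ?_) fun _ => ?_
  · exact .bind fun u _ => post_simpleSend hs (GoodBody.qbody .nil)
  refine .ite (fun _ => ?_) fun _ => ?_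
  · refine .bind fun u _ => .bind fun uris huris => post_simpleSend hs (GoodBody.qbody ?_)
    -- The order in which the set is listed is arbitrary; only membership in the list matters.
    obtain ⟨l, -, hl, rfl⟩ := huris
    refine GoodBody.dict [(K.redirect_uris, .seq l)] ?_
    simp only [List.mem_singleton, forall_eq]
    refine fun _ => ⟨l, rfl, fun u hu => ?_⟩
    obtain ⟨d, hd, rfl⟩ := (hl u).1 hu
    exact goodURI_url hd _ _ _
  -- The remaining branch sends the authorization redirect. It is a symmetrically encrypted response
  -- and leaves `pendingDNS` alone; the case split is on whether a nonce is added to its data.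
  · iterate 4 refine .bind fun _ _ => ?_
    refine .ite (fun _ => ?_) fun _ => ?_
    all_goals
      repeat refine .bind fun _ _ => ?_
      exact .stopWith (RPGood.encs hs _ _)

theorem post_sendTokenRequest {ds : Finset Str} {sessionId code : PTerm A N} {a : A}
    {s : RPState A N} (hs : GoodDNS ds s.pendingDNS) :
    Post (OnSome (RPGood ds)) (sendTokenRequest sessionId code a s) := by
  unfold sendTokenRequest
  refine .bind fun _ _ => .bind fun _ _ => .bind fun _ _ => .bind fun _ _ =>
    .bind fun redirectUri _ => .bind fun clientId _ => .bind fun clientSecret _ => ?_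
  -- The keys, including the singular `redirect_uri`, all differ from `redirect_uris`, so nothing
  -- needs to be known about the values, which may come from the network.
  have h₀ := GoodBody.dict (ds := ds) [(K.grant_type, .str K.authorization_code), (K.code, code),
    (K.redirect_uri, redirectUri)] (by simp +decide)
  refine .ite (fun _ => .bind fun body hbody => ?_) fun _ => .bind fun body hbody => ?_
  · exact .bind fun _ _ => .bind fun _ _ => post_simpleSend hs (GoodBody.qbody
      (h₀.update GoodEntry.congr (GoodEntry.of_ne (by decide) _) hbody))
  · obtain rfl := Set.mem_singleton_iff.1 hbody
    exact .bind fun _ _ => .bind fun _ _ => post_simpleSend hs (GoodBody.qbody h₀)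

theorem post_useAccessToken {ds : Finset Str} {sessionId token : PTerm A N} {a : A}
    {s : RPState A N} (hs : GoodDNS ds s.pendingDNS) :
    Post (OnSome (RPGood ds)) (useAccessToken sessionId token a s) := by
  unfold useAccessToken
  iterate 6 refine .bind fun _ _ => ?_
  exact post_simpleSend hs (GoodBody.qbody .nil)

theorem post_checkIdToken {ds : Finset Str} {sessionId idToken : PTerm A N}
    {s : RPState A N} (hs : GoodDNS ds s.pendingDNS) :
    Post (OnSome (RPGood ds)) (checkIdToken sessionId idToken s) := by
  unfold checkIdToken
  repeat refine .bind fun _ _ => ?_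
  repeat refine .ite (fun _ => .pure trivial) fun _ => ?_
  repeat refine .bind fun _ _ => ?_
  exact .stopWith (RPGood.encs hs _ _)

theorem post_rpResponse {ds : Finset Str} {m reference request key : PTerm A N} {a f : A}
    {s : RPState A N} (hs : GoodDNS ds s.pendingDNS) :
    Post (OnSome (RPGood ds)) (rpResponse ds m reference request key a f s) := by
  unfold rpResponse
  repeat refine .bind fun _ _ => ?_
  refine .ite (fun _ => ?_) fun _ => .ite (fun _ => ?_) fun _ => .ite (fun _ => ?_) fun _ =>
    .ite (fun _ => ?_) fun _ => .ite (fun _ => ?_) fun _ => .pure trivial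
  · repeat refine .bind fun _ _ => ?_
    repeat refine .ite (fun _ => .pure trivial) fun _ => ?_
    exact .bind fun _ _ => post_startLoginFlow hs
  · refine .bind fun _ _ => .ite (fun _ => .pure trivial) fun _ => ?_
    exact .bind fun _ _ => post_startLoginFlow hs
  · exact .bind fun _ _ => post_startLoginFlow hs
  · exact .bind fun _ _ => post_startLoginFlow hs
  · repeat refine .bind fun _ _ => ?_
    exact .ite (fun _ => post_useAccessToken hs) fun _ => post_checkIdToken hs

theorem post_rpRequest {ds : Finset Str} {m k : PTerm A N} {a f : A}
    {s : RPState A N} (hs : GoodDNS ds s.pendingDNS) :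
    Post (OnSome (RPGood ds)) (rpRequest ds m k a f s) := by
  unfold rpRequest
  refine .bind fun _ _ => .ite (fun _ => .stopWith (RPGood.encs hs _ _)) fun _ =>
    .ite (fun _ => ?_) fun _ => .ite (fun _ => ?_) fun _ => .pure trivial
  · refine .ite (fun _ => .pure trivial) fun _ => ?_
    exact .bind fun _ _ => post_startLoginFlow hs
  · refine .bind fun _ _ => .bind fun _ _ => .ite (fun _ => .pure trivial) fun _ => ?_
    refine .bind fun _ _ => .bind fun _ _ => .bind fun _ _ => .bind fun _ _ =>
      .ite (fun _ => .pure trivial) fun _ => ?_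
    refine .bind fun _ _ => .ite (fun _ => .stopWith (RPGood.encs hs _ _)) fun _ => ?_
    refine .bind fun _ _ => .bind fun _ _ => .ite (fun _ => .pure trivial) fun _ => ?_
    iterate 5 refine .bind fun _ _ => ?_
    refine .ite (fun _ => ?_) fun _ => ?_
    all_goals
      refine .bind fun _ _ => .bind fun _ _ => ?_
      exact .ite (fun _ => post_checkIdToken hs) fun _ => .ite (fun _ => post_useAccessToken hs)
        fun _ => .ite (fun _ => post_sendTokenRequest hs) fun _ => .pure trivial

/-- The results of a server either are those of a corrupted one, or were computed in a state that is
not corrupted. -/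
theorem post_corrupt {X : Type} {srv : Server A N X} {Doms : Finset Str} {m : PTerm A N} {a f : A}
    {s : ServerState A N X} :
    Post (OnSome fun _ s' => (∃ l, s'.corrupt = .seq l) ∨ s.corrupt ≡ₜ .bot)
      (serverMain Doms srv a f m s) := by
  unfold serverMain
  refine .ite (fun _ => ?_) fun hc => ?_
  · exact .bind fun _ _ => .bind fun _ _ => .pure (.inl ⟨_, rfl⟩)
  · rintro (_ | ⟨E, s'⟩) -
    exacts [trivial, .inr (by_contra fun h => hc (.inl h))]

/-- The first alternative covers the branch of a corrupted server, which may output anything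
derivable but leaves a sequence in `corrupt`. In all other branches a request is sent only after it
has been taken from `pendingDNS`. -/
theorem post_rpMain {Doms ds : Finset Str} {m : PTerm A N} {a f : A} {s : RPState A N}
    (hs : GoodDNS ds s.pendingDNS) :
    Post (OnSome fun E s' => (∃ l, s'.corrupt = .seq l) ∨ RPGood ds E s')
      (serverMain Doms (rpServer ds) a f m s) := by
  have weaken {M : Set (RPResult A N)} (h : Post (OnSome (RPGood ds)) M) :
      Post (OnSome fun E s' => (∃ l, s'.corrupt = .seq l) ∨ RPGood ds E s') M := by
    rintro (_ | ⟨E, s'⟩) ho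
    exacts [trivial, .inr (h _ ho)]
  unfold serverMain
  refine .ite (fun _ => ?_) fun hc => ?_
  · exact .bind fun _ _ => .bind fun _ _ => .pure (.inl ⟨_, rfl⟩)
  refine weaken ?_
  refine .ite (fun _ => ?_) fun _ => .ite (fun _ => ?_) fun _ => .ite (fun _ => ?_) fun _ =>
    .ite (fun _ => .pure trivial) fun _ => ?_
  · exact .bind fun _ _ => .ite (fun _ => .pure trivial) fun _ => post_rpRequest hs
  · refine .ite (fun _ => .pure trivial) fun hk => .bind fun entry hentry =>
      .ite (fun _ => .pure trivial) fun _ => ?_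
    refine .bind fun _ _ => .bind fun p hp => .stopWith fun _ _ =>
      ⟨hs.removeKey GoodPending.congr hp, ?_⟩
    simp only [List.mem_singleton, forall_eq]
    refine .inr (.inr ⟨_, _, _, rfl, ?_⟩)
    -- The test for the key excludes the default value of `lookup`, so the entry really is stored in
    -- `pendingDNS` and the invariant applies to it.
    have h := hentry.resolve_right fun h => hk (by simpa using h.1)
    have he : Term.proj 2 (.seq [m.dnonce.nf, entry]) ≡ₜ entry := proj_seq_eqv (i := 1) rfl
    exact AllElems.congr ((((he.proj 2).trans (comp_eqv _ _).symm).proj 8).trans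
      (comp_eqv _ _).symm) (hs.of_mem GoodPending.congr h)
  · exact .bind fun x _ => .ite (fun _ => .pure trivial) fun _ => .bind fun _ _ =>
      post_rpResponse (request := x.2.1) (key := x.2.2.1) (f := f) hs
  · rintro _ rfl
    trivial


-- Identity providers: how the registered clients change

/-- The step neither changes the registered clients nor removes a registration request. -/
def KeepsClients (s : IdPState A N) (_ : List (Event A (PTerm A N))) (s' : IdPState A N) : Prop :=
  s'.app.clients = s.app.clients ∧
    (elems s.app.registrationRequests).length ≤ (elems s'.app.registrationRequests).length

theorem KeepsClients.refl (s : IdPState A N) (E : List (Event A (PTerm A N))) :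
    KeepsClients s E s := ⟨rfl, le_rfl⟩

theorem post_idpAuth2 {di : Finset Str} {P : PTerm A N → PTerm A N → Prop} {m k : PTerm A N}
    {a f : A} {s : IdPState A N} : Post (OnSome (KeepsClients s)) (idpAuth2 di P m k a f s) := by
  unfold idpAuth2
  refine .bind fun _ _ => .bind fun _ _ => .ite (fun _ => .pure trivial) fun _ =>
    .ite (fun _ => .pure trivial) fun _ => ?_
  iterate 5 refine .bind fun _ _ => ?_
  refine .ite (fun _ => .pure trivial) fun _ => .bind fun _ _ => .bind fun _ _ =>
    .ite (fun _ => .pure trivial) fun _ => .ite (fun _ => .pure trivial) fun _ => ?_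
  exact .bind fun _ _ => .stopWith fun _ _ => ⟨rfl, le_rfl⟩

theorem post_idpToken {m k : PTerm A N} {a f : A} {s : IdPState A N} :
    Post (OnSome (KeepsClients s)) (idpToken m k a f s) := by
  unfold idpToken
  iterate 5 refine .bind fun _ _ => ?_
  refine .ite (fun _ => .pure trivial) fun _ => .bind fun _ _ =>
    .ite (fun _ => .pure trivial) fun _ => ?_
  iterate 4 refine .bind fun _ _ => ?_
  refine .ite (fun _ => .pure trivial) fun _ => .ite (fun _ => .pure trivial) fun _ => ?_
  iterate 6 refine .bind fun _ _ => ?_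
  exact .stopWith fun _ _ => ⟨rfl, le_rfl⟩

/-- A registration request is merely appended to the stored ones, which is why `KeepsClients` bounds
their number only from below. -/
theorem post_idpRequest {di : Finset Str} {ids : Set (Str × Str)}
    {P : PTerm A N → PTerm A N → Prop} {m k : PTerm A N} {a f : A} {s : IdPState A N} :
    Post (OnSome (KeepsClients s)) (idpRequest di ids P m k a f s) := by
  unfold idpRequest
  have unchanged {dst src msg : PTerm A N} : Post (OnSome (KeepsClients s)) (stopWith dst src msg s) :=
    .stopWith fun _ _ => .refl _ _
  refine .bind fun _ _ => .ite (fun _ => ?_) fun _ => .ite (fun _ => unchanged) fun _ =>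
    .ite (fun _ => unchanged) fun _ => .ite (fun _ => ?_) fun _ => .ite (fun _ => ?_) fun _ =>
    .ite (fun _ => post_idpAuth2) fun _ => .ite (fun _ => post_idpToken) fun _ => .pure trivial
  · exact .bind fun _ _ => .ite (fun _ => .pure trivial) fun _ => unchanged
  · exact .pure ⟨rfl, by simp [snoc]⟩
  · exact .ite (fun _ => .pure trivial) fun _ => unchanged

/-- The client id `c` is registered, and it was not registered before. -/
def AddsClient (c : PTerm A N) (s : IdPState A N) (_ : List (Event A (PTerm A N)))
    (s' : IdPState A N) : Prop :=
  ¬ HasKey s.app.clients c ∧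
    ∃ v, s'.app.clients = .seq (elems s.app.clients ++ [.seq [c, v]])

theorem post_idpOther {c : PTerm A N} {s : IdPState A N} :
    Post (OnSome (AddsClient c s)) (idpOther c s) := by
  unfold idpOther
  refine .ite (fun _ => .pure trivial) fun hc => .ite (fun _ => .pure trivial) fun _ =>
    .bind fun x _ => ?_
  unfold idpRegister
  iterate 4 refine .bind fun _ _ => ?_
  refine .bind fun clients hclients => .stopWith fun _ _ => ⟨hc, ?_⟩
  -- `update` would overwrite an entry only if the key were present, which the guard of the
  -- algorithm has excluded; so the record is appended.
  rcases hclients with ⟨l₁, v₀, l₂, h, -⟩ | ⟨-, h⟩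
  · exact absurd ⟨v₀, by simp [h]⟩ hc
  · exact ⟨_, h⟩

/-- The list `l` is empty or a single placeholder, according to whether a client secret is issued.
The strict decrease in the number of stored requests separates this branch from those covered by
`KeepsClients`. -/
theorem post_idpRegister {c m k a f : PTerm A N} {s : IdPState A N} :
    Post (OnSome fun E s' =>
      (elems s'.app.registrationRequests).length < (elems s.app.registrationRequests).length ∧
      ∃ resp,
        (∃ l : List (PTerm A N),
          resp = dict ((K.client_id, c) :: l.map fun p => (.str K.client_secret, p))) ∧
        (∃ a' b', E = [⟨a', b', .encs (httpResp m.qnonce K.s201 nil resp) k⟩]) ∧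
        ∃ uris ∈ lookup m.qbody (.str K.redirect_uris),
        ∃ info ∈ update resp (.str K.redirect_uris) uris,
          s'.app.clients ∈ update s.app.clients c info)
      (idpRegister c m k a f s) := by
  unfold idpRegister
  refine .bind fun _ hreqs => .bind fun uris huris => .bind fun b _ => .bind fun info hinfo =>
    .bind fun clients hclients => .stopWith fun a' b' =>
    ⟨?_, _, ?_, ⟨a', b', rfl⟩, uris, huris, info, hinfo, hclients⟩
  · obtain ⟨l₁, l₂, y, h, -, rfl⟩ := hreqs
    simp [h]
  · split_ifs
    exacts [⟨[.var 4], rfl⟩, ⟨[], rfl⟩]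

/-- The branch of a corrupted server also falls under `KeepsClients`: it alters the component
`corrupt` only. Clients can thus be added solely through `idpOther`, with the incoming message as
client id. -/
theorem post_idpMain {Doms di : Finset Str} {ids : Set (Str × Str)}
    {P : PTerm A N → PTerm A N → Prop} {m : PTerm A N} {a f : A} {s : IdPState A N} :
    Post (OnSome fun E s' => KeepsClients s E s' ∨ AddsClient m s E s')
      (serverMain Doms (idpServer di ids P) a f m s) := by
  have left {M : Set (IdPResult A N)} (h : Post (OnSome (KeepsClients s)) M) :
      Post (OnSome fun E s' => KeepsClients s E s' ∨ AddsClient m s E s') M := by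
    rintro (_ | ⟨E, s'⟩) ho
    exacts [trivial, .inl (h _ ho)]
  unfold serverMain
  refine .ite (fun _ => ?_) fun hc => .ite (fun _ => ?_) fun _ => .ite (fun _ => ?_) fun _ =>
    .ite (fun _ => ?_) fun _ => .ite (fun _ => .pure trivial) fun _ => ?_
  · exact .bind fun _ _ => .bind fun _ _ => .pure (.inl ⟨rfl, le_rfl⟩)
  · exact .bind fun _ _ => .ite (fun _ => .pure trivial) fun _ => left post_idpRequest
  · refine .ite (fun _ => .pure trivial) fun hk => .bind fun _ _ =>
      .ite (fun _ => .pure trivial) fun _ => .bind fun _ _ => .bind fun _ _ =>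
      .stopWith fun _ _ => .inl ⟨rfl, le_rfl⟩
  · refine .bind fun _ _ => .ite (fun _ => .pure trivial) fun _ => .bind fun _ _ => ?_
    rintro _ rfl
    trivial
  · rintro (_ | ⟨E, s'⟩) ho
    exacts [trivial, .inr (post_idpOther _ ho)]

end Algorithms

-- From algorithms to processing steps

section Steps

variable {A N B R I W D : Type} {X : Setup A N B R I W D}

theorem eqv_instantiate {vs : Finset ℕ} {ν : Stream' N} {t u : PTerm A N} (h : t ≡ₜ u) :
    instantiate vs ν t ≡ₜ instantiate vs ν u := h.subst _

/-- In a step, every component of the old state and of the new state of an HTTPS server is obtained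
from the states of the algorithm. -/
theorem exists_of_algRel {X : Type} {srv : Server A N X} {doms : Finset Str}
    {e : Event A (Msg A N)} {S : Msg A N} {E : List (Event A (PTerm A N))} {s' : PTerm A N}
    (h : algRel srv.toTerm (serverMain doms srv) e S E s') :
    ∃ σ, S.lift = srv.toTerm σ ∧ ((E = [] ∧ s' = S.lift) ∨ ∃ σ', s' = srv.toTerm σ' ∧
      some (E, σ') ∈ serverMain doms srv e.dst e.src e.msg.lift σ) := by
  obtain ⟨σ, hσ, o, ho, h⟩ := h
  rcases o with _ | ⟨E₁, σ'⟩
  · exact ⟨σ, hσ, .inl h⟩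
  · obtain ⟨rfl, rfl⟩ := h
    exact ⟨σ, hσ, .inr ⟨σ', rfl, ho⟩⟩

/-- Which nonces are drawn is irrelevant below. What matters is that the new state and all outputs
are instantiated in the same way. -/
theorem StepWith.exists_instantiate {P : Type} {sys : P → AtomicProcess A N} {c c' : Config P A N}
    {e : Event A (Msg A N)} {p : P} {E : List (Event A (PTerm A N))} {s : PTerm A N}
    {Eout : List (Event A (Msg A N))} (h : StepWith sys c e p E s Eout c') :
    ∃ vs ν, c'.S p = instantiate vs ν s ∧
      ∀ ev ∈ Eout, ∃ ev' ∈ E, ev.msg = instantiate vs ν ev'.msg := by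
  refine ⟨_, _, h.state, fun ev hev => ?_⟩
  rw [h.out] at hev
  obtain ⟨ev', hev', rfl⟩ := List.mem_map.1 hev
  exact ⟨ev', hev', rfl⟩

theorem comp_state {S : Msg A N} {t : PTerm A N} {l : List (PTerm A N)} {i : ℕ} {vs : Finset ℕ}
    {ν : Stream' N} {x : PTerm A N} (h : S = instantiate vs ν t) (ht : t = .seq l)
    (hi : l[i]? = some x) : comp S (i + 1) ≡ₜ instantiate vs ν x := by
  subst h ht
  exact (comp_eqv _ _).trans (eqv_instantiate (proj_seq_eqv hi))

theorem lift_comp {S : Msg A N} {l : List (PTerm A N)} {i : ℕ} {x : PTerm A N}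
    (h : S.lift = .seq l) (hi : l[i]? = some x) : (comp S (i + 1)).lift ≡ₜ x := by
  refine ((comp_eqv S (i + 1)).subst Empty.elim).trans ?_
  change Term.proj (i + 1) S.lift ≡ₜ x
  rw [h]
  exact proj_seq_eqv hi

/-- The instantiation is arbitrary because the old state has no placeholders. Choosing the one that
produces the new state makes old and new components comparable. -/
theorem comp_of_lift (vs : Finset ℕ) (ν : Stream' N) {S : Msg A N} {l : List (PTerm A N)} {i : ℕ}
    {x : PTerm A N} (h : S.lift = .seq l) (hi : l[i]? = some x) :
    comp S (i + 1) ≡ₜ instantiate vs ν x := by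
  have := eqv_instantiate (vs := vs) (ν := ν) (lift_comp h hi)
  rwa [instantiate_lift] at this

/-- The constructors for sequences and encryptions are never reduced at the root and survive
instantiation. So only the third form of output can be equivalent to a public-key encryption, and
comparing arguments identifies the requests. -/
theorem goodBody_of_goodOut {ds : Finset Str} {t : PTerm A N} (ht : GoodOut ds t) {vs : Finset ℕ}
    {ν : Stream' N} {m k K : Msg A N} (h : instantiate vs ν t ≡ₜ .enc (.seq [m, k]) K) :
    GoodBody ds m.qbody := by
  rcases ht with ⟨l, rfl⟩ | ⟨x, k', rfl⟩ | ⟨m', x, k', rfl, hm⟩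
  · simp [instantiate, Eqv, nf] at h
  · simp [instantiate, Eqv, nf] at h
  · have h' : instantiate vs ν m' ≡ₜ m := by
      simp only [instantiate, Eqv, nf, nfList, subst_enc, subst_seq, List.map_cons, Term.enc.injEq,
        Term.seq.injEq, List.cons.injEq] at h
      exact h.1.1
    refine AllElems.congr (t := instantiate vs ν m'.qbody) ?_ (hm.subst _ (GoodEntry.subst _))
    exact ((comp_eqv _ _).subst _).trans ((h'.proj 8).trans (comp_eqv _ _).symm)

/-- Honesty is assumed after the step: this excludes the corrupted branch, and any other branch is
entered only from an uncorrupted state. The invariant then gives both its own preservation and the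
goodness of the requests sent. -/
theorem rp_step {r : R} {c c' : Config (Party B R I W D) A N} {e : Event A (Msg A N)}
    {E : List (Event A (PTerm A N))} {s : PTerm A N} {Eout : List (Event A (Msg A N))}
    (h : StepWith X.process c e (.rp r) E s Eout c') (hon : Setup.Honest (.rp r) c') :
    Setup.Honest (.rp r) c ∧ (GoodDNS (X.dom (.rp r)) (comp (c.S (.rp r)) 2) →
      GoodDNS (X.dom (.rp r)) (comp (c'.S (.rp r)) 2) ∧
      ∀ ev ∈ Eout, ∀ m k K, ev.msg ≡ₜ .enc (.seq [m, k]) K → GoodBody (X.dom (.rp r)) m.qbody) := by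
  obtain ⟨σ, hσ, ⟨rfl, rfl⟩ | ⟨σ', rfl, hσ'⟩⟩ := exists_of_algRel h.rel
  · have hS : c'.S (.rp r) = c.S (.rp r) := by rw [h.state, instantiate_lift]
    unfold Setup.Honest at *
    rw [hS] at hon ⊢
    refine ⟨hon, fun hg => ⟨hg, ?_⟩⟩
    simp [h.out]
  · obtain ⟨vs, ν, hstate, hout⟩ := h.exists_instantiate
    have hc := comp_of_lift vs ν (i := 3) hσ rfl
    have hc' := comp_state (i := 3) hstate rfl rfl
    -- A sequence remains a sequence under instantiation and is never equivalent to ⊥.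
    have hcorrupt : ¬ ∃ l, σ'.corrupt = .seq l := by
      rintro ⟨l, hl⟩
      have := hc'.symm.trans hon
      simp [hl, instantiate, Eqv, nf] at this
    refine ⟨hc.trans (eqv_instantiate ((post_corrupt _ hσ').resolve_left hcorrupt)), fun hg => ?_⟩
    have hs : GoodDNS (X.dom (.rp r)) σ.pendingDNS :=
      AllElems.congr (lift_comp (i := 1) hσ rfl) (hg.subst _ (GoodPending.subst _))
    obtain ⟨hs', hE⟩ := (post_rpMain hs _ hσ').resolve_left hcorrupt
    refine ⟨AllElems.congr (comp_state (i := 1) hstate rfl rfl).symm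
      (hs'.subst _ (GoodPending.subst _)), ?_⟩
    intro ev hev m k K hm
    obtain ⟨ev', hev', h⟩ := hout ev hev
    exact goodBody_of_goodOut (hE ev' hev') (h ▸ hm)

/-- A term equivalent to the lift of a message `C` is instantiated to `C` up to equivalence, for
every choice of nonces. Hence its elements correspond to those of `C`; `exists_mem_elems_lift` is
the other direction. -/
theorem instantiate_nf_lift_mem {vs : Finset ℕ} {ν : Stream' N} {C : Msg A N} {t y : PTerm A N}
    (hC : C.lift ≡ₜ t) (hy : y ∈ elems t) : (instantiate vs ν y).nf ∈ elems C := by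
  have h := mem_elems_subst (fun v => (.nonce (ν.get (vs.filter (· < v)).card) : Msg A N)) hy
  rwa [← elems_congr (hC.subst _), subst_lift_msg] at h

theorem exists_mem_elems_lift (vs : Finset ℕ) (ν : Stream' N) {C z : Msg A N} {t : PTerm A N}
    (hC : C.lift ≡ₜ t) (hz : z ∈ elems C) : ∃ y ∈ elems t, (instantiate vs ν y).nf = z := by
  refine ⟨_, elems_congr hC ▸ mem_elems_subst Empty.elim hz, ?_⟩
  rw [show (instantiate vs ν _).nf = _ from eqv_instantiate (nf_eqv _)]
  change (instantiate vs ν z.lift).nf = z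
  rw [instantiate_lift, nf_of_mem_elems hz]

/-- The two halves are designed for induction along a run: the first keeps keys forward in time, the
second traces an entry backward as long as its key was already present. -/
theorem idp_step {i : I} {c c' : Config (Party B R I W D) A N} {e : Event A (Msg A N)}
    {E : List (Event A (PTerm A N))} {s : PTerm A N} {Eout : List (Event A (Msg A N))}
    (h : StepWith X.process c e (.idp i) E s Eout c') :
    (∀ k, HasKey (comp (c.S (.idp i)) 8) k → HasKey (comp (c'.S (.idp i)) 8) k) ∧
    ∀ k v, .seq [k.nf, v] ∈ elems (comp (c'.S (.idp i)) 8) →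
      .seq [k.nf, v] ∈ elems (comp (c.S (.idp i)) 8) ∨ ¬ HasKey (comp (c.S (.idp i)) 8) k := by
  obtain ⟨σ, hσ, ⟨rfl, rfl⟩ | ⟨σ', rfl, hσ'⟩⟩ := exists_of_algRel h.rel
  · rw [h.state, instantiate_lift]
    exact ⟨fun _ => id, fun _ _ => .inl⟩
  obtain ⟨vs, ν, hstate, -⟩ := h.exists_instantiate
  -- The six generic components and `registrationRequests` precede `clients`, so it is component 8,
  -- or index 7 when counted from 0.
  have hC := comp_of_lift vs ν (i := 7) hσ rfl
  have hC' := comp_state (i := 7) hstate rfl rfl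
  have hlift := lift_comp (i := 7) hσ rfl
  rcases post_idpMain _ hσ' with ⟨hcl, -⟩ | ⟨hk, v₀, hcl⟩
  · rw [hcl] at hC'
    have hCC := elems_congr (hC'.trans hC.symm)
    unfold HasKey
    rw [hCC]
    exact ⟨fun _ => id, fun _ _ => .inl⟩
  · rw [hcl] at hC'
    simp only [instantiate, subst_seq] at hC'
    have hCC := elems_congr hC'
    rw [elems_seq] at hCC
    unfold HasKey
    rw [hCC]
    simp only [List.map_append, List.map_map, List.mem_append, List.mem_map, Function.comp,
      List.mem_singleton]
    refine ⟨?_, ?_⟩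
    · rintro k ⟨v, hv⟩
      obtain ⟨y, hy, hyv⟩ := exists_mem_elems_lift vs ν hlift hv
      exact ⟨v, .inl ⟨y, hy, hyv⟩⟩
    · rintro k v (⟨y, hy, hyv⟩ | ⟨y, rfl, hyv⟩)
      · left
        rw [← hyv]
        exact instantiate_nf_lift_mem hlift hy
      · right
        intro hkey
        -- For the appended entry, the key `k` is equivalent to the incoming message. If it had been
        -- present in the message state, it would also be present in the lifted state, against the
        -- guard of the algorithm.
        refine hk ((HasKey.subst Empty.elim hkey).congr hlift ?_)
        simp only [subst_seq, nf_seq, List.map_cons, List.map_nil, Term.seq.injEq, List.cons.injEq,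
          subst_lift_msg] at hyv
        exact Eqv.subst _ hyv.1.symm

/-- Needed to identify the algorithm states named in `Setup.SendsRegResponse` with those through
which the server process made the step. -/
theorem idpServer_toTerm_injective {di : Finset Str} {ids : Set (Str × Str)}
    {P : PTerm A N → PTerm A N → Prop} : Function.Injective (idpServer di ids P).toTerm := by
  rintro ⟨_, _, _, _, _, _, ⟨_, _, _, _⟩⟩ ⟨_, _, _, _, _, _, ⟨_, _, _, _⟩⟩ h
  simpa [Server.toTerm, idpServer, and_assoc] using h

/-- The response determines which client id was registered, and the record under it is the response
body extended by the value of `redirect_uris` in `m`. Goodness thus passes from the body of the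
request to the record. -/
theorem idp_register {E₀ : Stream' (Event A (Msg A N))} {ρ : Run X.process E₀ X.fresh} {n : ℕ}
    {i : I} {m k m' c c' : Msg A N} (h : Setup.SendsRegResponse ρ n i m k m')
    (hkey : HasKey m'.pbody K.client_id)
    (hc' : c' ∈ lookup m'.pbody K.client_id) (hc : c ≡ₜ c') :
    ¬ HasKey (comp ((ρ.conf n).S (.idp i)) 8) c ∧
    HasKey (comp ((ρ.conf (n + 1)).S (.idp i)) 8) c ∧ ∀ ds, GoodBody ds m.qbody → ∀ v,
      .seq [c.nf, v] ∈ elems (comp ((ρ.conf (n + 1)).S (.idp i)) 8) → GoodBody ds v := by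
  obtain ⟨-, e, E, s, Eout, hstep, ⟨a, f, σ, σ', hσ, rfl, -, hreg⟩, ev, hev, hevm⟩ := h
  obtain ⟨hlen, resp, ⟨l, hl⟩, ⟨a', b', rfl⟩, uris, huris, info, hinfo, hclients⟩ :=
    post_idpRegister _ hreg
  -- That the response was produced by `idpRegister` does not yet say that the client id was new.
  -- The same transition is one of `serverMain`, and there the shortened list of requests leaves
  -- only the guarded branch. `AddsClient` ignores its output argument, hence the empty list.
  have hadd : AddsClient e.msg.lift σ [] σ' := by
    obtain ⟨σ₁, hσ₁, ⟨h, -⟩ | ⟨σ₂, hσ₂, hmem⟩⟩ := exists_of_algRel hstep.rel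
    · simp at h
    · obtain rfl := idpServer_toTerm_injective (hσ.symm.trans hσ₁)
      obtain rfl := idpServer_toTerm_injective hσ₂
      exact (post_idpMain _ hmem).resolve_left fun h => absurd h.2 (by omega)
  have hk := hadd.1
  have hlift := lift_comp (i := 7) hσ rfl
  obtain ⟨vs, ν, hstate, hout⟩ := hstep.exists_instantiate
  have hC' := comp_state (i := 7) hstate rfl rfl
  have hresp : Term.pbody m' ≡ₜ dict ((.str K.client_id, e.msg) :: l.map fun p =>
      (.str K.client_secret, instantiate vs ν p)) := by
    obtain ⟨ev', hev', hmsg⟩ := hout ev hev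
    rw [List.mem_singleton.1 hev'] at hmsg
    rw [hmsg] at hevm
    have h₁ : instantiate vs ν (httpResp m.lift.qnonce K.s201 nil resp) ≡ₜ m' :=
      eqv_of_encs_eqv hevm
    refine (comp_eqv _ _).trans ((h₁.symm.proj 5).trans ?_)
    simp only [httpResp, instantiate, subst_seq, List.map_cons, List.map_nil]
    refine (proj_seq_eqv (i := 4) rfl).trans ?_
    simp [hl, dict, Function.comp_def, Eqv]
  -- The keys `client_id` and `client_secret` are different strings, so the only value under the
  -- former is the message that triggered the step.
  have hce : c ≡ₜ e.msg := by
    have h := hc'.resolve_right fun h => h.1 hkey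
    rw [elems_congr hresp, dict, elems_seq] at h
    simp +decide [nf, nfList, K.client_id, K.client_secret] at h
    exact hc.trans (h ▸ nf_eqv _)
  have hkC : ¬ HasKey (comp ((ρ.conf n).S (.idp i)) 8) c := fun h =>
    hk ((HasKey.subst Empty.elim h).congr hlift (hce.subst _))
  rcases hclients with ⟨l₁, v₀, l₂, h, -⟩ | ⟨-, h⟩
  · exact absurd ⟨v₀, by simp [h]⟩ hk
  rw [h] at hC'
  simp only [instantiate, subst_seq] at hC'
  have hCC := elems_congr hC'
  rw [elems_seq] at hCC
  unfold HasKey at hkC ⊢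
  rw [hCC]
  simp only [List.map_append, List.map_map, List.mem_append, List.mem_map, Function.comp,
    List.mem_singleton]
  refine ⟨hkC, ⟨_, .inr ⟨_, rfl, by simp [show c.nf = _ from hce]; rfl⟩⟩, fun ds hm v hv => ?_⟩
  -- The only entry of the record under `redirect_uris` is the value looked up in the request body.
  -- The lookup is made in the lifted request, so goodness of `m` is lifted beforehand.
  have hgood : GoodBody ds info := by
    have hm' : GoodBody ds (m.lift : PTerm A N).qbody :=
      AllElems.congr (((comp_eqv m 8).subst Empty.elim).trans (comp_eqv _ _).symm)
        (hm.subst Empty.elim (GoodEntry.subst _))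
    refine AllElems.update GoodEntry.congr ?_ ⟨_, _, rfl, fun _ => hm'.lookup huris⟩ hinfo
    have h := GoodBody.dict (ds := ds)
      ((K.client_id, e.msg.lift) :: l.map fun p => (K.client_secret, p)) (by simp +decide)
    simpa [hl, Function.comp_def] using h
  -- An entry that was there before would make `c` an old key; the appended entry is an instance of
  -- `info`.
  rcases hv with ⟨y, hy, hyv⟩ | ⟨y, rfl, hyv⟩
  · exact absurd ⟨v, hyv ▸ instantiate_nf_lift_mem hlift hy⟩ hkC
  · simp only [subst_seq, nf_seq, List.map_cons, List.map_nil, Term.seq.injEq, List.cons.injEq,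
      and_true] at hyv
    rw [← hyv.2]
    exact (hgood.subst _ (GoodEntry.subst _)).congr (nf_eqv _).symm

-- Invariants along runs

/-- The state of a process changes only in its own steps. -/
theorem Run.step_of_party {P : Type} {sys : P → AtomicProcess A N}
    {E₀ : Stream' (Event A (Msg A N))} {N₀ : Stream' N} (ρ : Run sys E₀ N₀) (p : P) {n : ℕ}
    (hn : (n : ℕ∞) < ρ.len) : (ρ.conf (n + 1)).S p = (ρ.conf n).S p ∨
      ∃ e E s Eout, StepWith sys (ρ.conf n) e p E s Eout (ρ.conf (n + 1)) := by
  obtain ⟨e, q, E, s, Eout, h⟩ := ρ.step n hn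
  by_cases hpq : p = q
  · subst hpq
    exact .inr ⟨e, E, s, Eout, h⟩
  · exact .inl (h.state_ne p hpq)

variable {E₀ : Stream' (Event A (Msg A N))} (ρ : Run X.process E₀ X.fresh)

theorem lt_len {n m : ℕ} (h : n < m) (hm : (m : ℕ∞) ≤ ρ.len) : (n : ℕ∞) < ρ.len :=
  (Nat.cast_lt.2 h).trans_le hm

/-- Honesty is inherited by earlier configurations, because no step turns a corrupted relying party
back into an honest one. The induction hence runs on the later index, descending step by step. -/
theorem honest_mono {r : R} {n m : ℕ} (hnm : n ≤ m) (hm : (m : ℕ∞) ≤ ρ.len)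
    (h : Setup.Honest (.rp r) (ρ.conf m)) : Setup.Honest (.rp r) (ρ.conf n) := by
  induction m, hnm using Nat.le_induction with
  | base => exact h
  | succ m _ ih =>
    have hlt := lt_len ρ m.lt_succ_self hm
    refine ih hlt.le ?_
    rcases ρ.step_of_party (.rp r) hlt with hS | ⟨e, E, s, Eout, hs⟩
    · unfold Setup.Honest at *
      rwa [← hS]
    · exact (rp_step hs h).1

theorem goodDNS_of_honest (hX : X.IsSystem) {r : R} {n : ℕ} (hn : (n : ℕ∞) ≤ ρ.len)
    (h : Setup.Honest (.rp r) (ρ.conf n)) :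
    GoodDNS (X.dom (.rp r)) (comp ((ρ.conf n).S (.rp r)) 2) := by
  induction n with
  | zero =>
    rw [ρ.init_S]
    obtain ⟨tlskeys, -, l, hl, hf⟩ := hX.init (.rp r)
    change GoodDNS _ (comp (X.init (.rp r)) 2)
    rw [hl]
    obtain _ | ⟨-, _ | ⟨h₂, -⟩⟩ := hf
    -- Initially `pendingDNS` is the empty tuple, but initial states are fixed only up to
    -- equivalence in each component.
    exact AllElems.congr (h₂.symm.trans
      ((proj_seq_eqv (i := 1) rfl).symm.trans (comp_eqv _ _).symm)) AllElems.nil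
  | succ n ih =>
    have hlt := lt_len ρ n.lt_succ_self hn
    have hpre := ih hlt.le (honest_mono ρ n.le_succ hn h)
    rcases ρ.step_of_party (.rp r) hlt with hS | ⟨e, E, s, Eout, hs⟩
    · rwa [hS]
    · exact ((rp_step hs h).2 hpre).1

theorem hasKey_clients_mono {i : I} {c : Msg A N} {n m : ℕ} (hnm : n ≤ m)
    (hm : (m : ℕ∞) ≤ ρ.len) (h : HasKey (comp ((ρ.conf n).S (.idp i)) 8) c) :
    HasKey (comp ((ρ.conf m).S (.idp i)) 8) c := by
  induction m, hnm using Nat.le_induction with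
  | base => exact h
  | succ m _ ih =>
    have hlt := lt_len ρ m.lt_succ_self hm
    rcases ρ.step_of_party (.idp i) hlt with hS | ⟨e, E, s, Eout, hs⟩
    · rw [hS]
      exact ih hlt.le
    · exact (idp_step hs).1 c (ih hlt.le)

/-- The record of a client id that is registered does not change any more. -/
theorem clients_entry_of_le {i : I} {c v : Msg A N} {n m : ℕ} (hnm : n ≤ m)
    (hm : (m : ℕ∞) ≤ ρ.len) (h : HasKey (comp ((ρ.conf n).S (.idp i)) 8) c)
    (hv : .seq [c.nf, v] ∈ elems (comp ((ρ.conf m).S (.idp i)) 8)) :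
    .seq [c.nf, v] ∈ elems (comp ((ρ.conf n).S (.idp i)) 8) := by
  induction m, hnm using Nat.le_induction with
  | base => exact hv
  | succ m hnm ih =>
    have hlt := lt_len ρ m.lt_succ_self hm
    refine ih hlt.le ?_
    rcases ρ.step_of_party (.idp i) hlt with hS | ⟨e, E, s, Eout, hs⟩
    · rwa [← hS]
    -- An entry not present before the step would have a key that was absent, but the key has been
    -- there since configuration `n`.
    · exact ((idp_step hs).2 c v hv).resolve_right fun h' =>
        h' (hasKey_clients_mono ρ hnm hlt.le h)

end Steps
end OIDC

-- The main theorem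

open OIDC in
theorem mainTheorem8 {A N B R I W D : Type} [Finite B] [Finite R] [Finite I]
    (X : Setup A N B R I W D) (hX : X.IsNetworkSystem ∨ X.IsWebSystem)
    (E₀ : Stream' (Event A (Msg A N))) (hE₀ : X.IsInitialEvents E₀)
    (ρ : Run X.process E₀ X.fresh) (n : ℕ) (hn : (n : ℕ∞) ≤ ρ.len)
    (i : I) (hi : Setup.Honest (.idp i) (ρ.conf n))
    (r : R) (hr : Setup.Honest (.rp r) (ρ.conf n))
    (c : Msg A N) (hc : Setup.Issued ρ c r i)
    (client : Msg A N) (hclient : client ∈ lookup (comp ((ρ.conf n).S (.idp i)) 8) c)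
    (uris : Msg A N) (huris : uris ∈ lookup client K.redirect_uris)
    (u : Msg A N) (hu : Mem u uris) :
    (∃ d ∈ X.dom (.rp r), u.host ≡ₜ .str d) ∧ u.protocol ≡ₜ .str K.HTTPS := by
  have hsys : X.IsSystem := hX.elim (·.toIsSystem) (·.toIsSystem)
  obtain ⟨n₁, n₂, m, k, m', h₁₂, hreq, hresp, hkey, c', hc', hcc'⟩ := hc
  suffices hgood : GoodBody (X.dom (.rp r)) client by
    obtain ⟨y, hy, huy⟩ := hu
    exact GoodURI.congr y u huy.symm ((hgood.lookup huris).of_mem GoodURI.congr hy)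
  -- If `c` has no record in this configuration, the looked-up value is the empty tuple, which is
  -- good for lack of entries.
  rcases hclient with hclient | ⟨-, rfl⟩
  swap
  · exact .nil
  obtain ⟨hnew, hadded, hgood⟩ := idp_register hresp hkey hc' hcc'
  -- The id was not registered before step `n₂`, and keys persist; a configuration that has a record
  -- for it must come after that step.
  have hlt : n₂ < n := by
    by_contra hle
    exact hnew (hasKey_clients_mono ρ (not_lt.1 hle) hresp.1.le ⟨client, hclient⟩)
  have hn₁ := h₁₂.trans hlt
  obtain ⟨-, e, E, s, Eout, hs, ev, hev, K, hK⟩ := hreq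
  -- `rp_step` needs honesty after the sending step, in configuration `n₁ + 1`; since `n₁ < n`, this
  -- follows from honesty at `n`.
  have hm := ((rp_step hs (honest_mono ρ hn₁ hn hr)).2 (goodDNS_of_honest ρ hsys
    (lt_len ρ hn₁ hn).le (honest_mono ρ hn₁.le hn hr))).2 ev hev m k K hK
  exact hgood _ hm client (clients_entry_of_le ρ hlt hn hadded hclient)
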